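/- Conventions. A noncommutative probability space is a pair $(\mathcal A,\varphi)$ of a unital complex algebra and a linear functional $\varphi:\mathcal A\to\mathbb C$ with $\varphi(1)=1$; it is a $C^*$-probability space if $\mathcal A$ is a unital $C^*$-algebra and $\varphi$ is positive. Subsets $S,T\subseteq\mathcal A$ are free if $\varphi(x_1\cdots x_n)=0$ whenever $n\ge 1$, $\varphi(x_k)=0$ for all $k$, and the $x_k$ are taken alternately from the unital subalgebras generated by $S$ and by $T$. For $a\in\mathcal A$ put $M_a(z)=\sum_{n\ge1}\varphi(a^n)z^n$, and let $R_a(z)=\sum_{n\ge1}\kappa_n z^n$ be the series determined by $\varphi(a^n)=\sum_{\pi\in NC(n)}\prod_{B\in\pi}\kappa_{|B|}$, $n\ge1$, where $NC(n)$ is the set of non-crossing partitions of $\{1,\dots,n\}$. A $*$-distribution is a linear functional $\mu$ on $\mathbb C\langle Z,Z^*\rangle$ with $\mu(1)=1$. Its $R$-transform $R_\mu$ is the power series in non-commuting indeterminates $z,z^*$, without constant term, whose coefficients $\mathrm{Cf}_w(R_\mu)$ are determined by $\mu(Z^w)=\sum_{\pi\in NC(n)}\prod_{B\in\pi}\mathrm{Cf}_{w|B}(R_\mu)$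 for all words $w$ of length $n\ge1$ over $\{1,*\}$, where $w|B$ is the restriction of $w$ to the positions in $B$. One calls $\mu$ $R$-diagonal if $R_\mu$ has the form $\sum_{n\ge1}\alpha_n(zz^*)^n+\sum_{n\ge1}\beta_n(z^*z)^n$; then $(\alpha_n)_{n\ge1}$ and $(\beta_n)_{n\ge1}$ are its determining sequences. The $*$-distribution of an element $x$ of a $C^*$-probability space $(\mathcal B,\psi)$ is the functional $P\mapsto\psi(P(x,x^*))$. If $\mu,\mu'$ are the $*$-distributions of elements $x,x'$ of a $C^*$-probability space such that $\{x,x^*\}$ is free from $\{x',(x')^*\}$, then $\mu\boxtimes\mu'$ denotes the $*$-distribution of $xx'$. Proposition. Let $\mu,\mu'$ be $R$-diagonal $*$-distributions of elements of $C^*$-probability spaces, with determining sequences $(\alpha_n),(\beta_n)$ and $(\alpha'_n),(\beta'_n)$ respectively. Let $a,b,a',b'$ be elements of a noncommutative probability space $(\mathcal A,\varphi)$ such that $\{a,b\}$ is free from $\{a',b'\}$ and $$R_a(z)=\sum_{n\ge1}\alpha_nz^n,\quad R_b(z)=\sum_{n\ge1}\beta_nz^n,\quad R_{a'}(z)=\sum_{n\ge1}\alpha'_nz^n,\quad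 R_{b'}(z)=\sum_{n\ge1}\beta'_nz^n .$$ Assume that $\beta_1\neq0\neq\alpha'_1$, so that $R_b$ and $R_{a'}$ have inverses $R_b^{\langle-1\rangle}$, $R_{a'}^{\langle-1\rangle}$ relative to composition. Then $\mu\boxtimes\mu'$ is $R$-diagonal, and its determining sequences $(\widehat\alpha_n)$, $(\widehat\beta_n)$ satisfy the following equalities of formal power series: $$\sum_{n\ge1}\widehat\alpha_nz^n=\bigl(R_a\circ R_b^{\langle-1\rangle}\circ M_{ba'}\bigr)(z),\qquad \sum_{n\ge1}\widehat\beta_nz^n=\bigl(R_{b'}\circ R_{a'}^{\langle-1\rangle}\circ M_{a'b}\bigr)(z).$$ -/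

import Mathlib

open scoped ComplexOrder

universe u v

/-! ### Non-crossing partitions and free cumulants -/

/-- A partition of `{0, …, n - 1}` is non-crossing if, whenever `i < j < k < l` with `i, k` in a
block `V` and `j, l` in a block `W`, one has `V = W`. -/
def IsNoncrossing {n : ℕ} (π : Finpartition (Finset.univ : Finset (Fin n))) : Prop :=
  ∀ V ∈ π.parts, ∀ W ∈ π.parts, ∀ i j k l : Fin n, i < j → j < k → k < l →
    i ∈ V → k ∈ V → j ∈ W → l ∈ W → V = W

open Classical in
/-- The finite set `NC(n)` of non-crossing partitions of an `n`-element ordered set. -/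
noncomputable def ncPartitions (n : ℕ) : Finset (Finpartition (Finset.univ : Finset (Fin n))) :=
  Finset.univ.filter IsNoncrossing

/-- The restriction `w | B` of a word `w` to a set `B` of positions. -/
def wordRestrict {ι : Type*} (w : List ι) (B : Finset (Fin w.length)) : List ι :=
  (B.sort (· ≤ ·)).map w.get

theorem length_wordRestrict {ι : Type*} (w : List ι) (B : Finset (Fin w.length)) :
    (wordRestrict w B).length = B.card := by
  simp [wordRestrict]

theorem wordRestrict_univ {ι : Type*} (w : List ι) : wordRestrict w Finset.univ = w := by
  simp [wordRestrict, Fin.sort_univ]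

open Classical in
/-- The free cumulants attached to a family `m` of numbers ("moments") indexed by the words over an
alphabet `ι`. They are obtained by solving the moment-cumulant formula
`m w = ∑_{π ∈ NC(n)} ∏_{B ∈ π} κ (w | B)`, `n = |w| ≥ 1`, for the term of the one-block partition;
see `moment_cumulant_formula`. The value at the empty word is `0`. -/
noncomputable def freeCumulant {ι : Type*} (m : List ι → ℂ) (w : List ι) : ℂ :=
  if w = [] then 0 else
    m w - ∑ π : {π : Finpartition (Finset.univ : Finset (Fin w.length)) //
        π ∈ ncPartitions w.length ∧ Finset.univ ∉ π.parts},
      ∏ B : {B : Finset (Fin w.length) // B ∈ π.1.parts}, freeCumulant m (wordRestrict w B.1)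
termination_by w.length
decreasing_by
  rw [length_wordRestrict]
  refine lt_of_le_of_ne (by simpa using Finset.card_le_univ B.1) fun h => π.2.2 ?_
  have hB : B.1 = Finset.univ := (Finset.card_eq_iff_eq_univ _).1 (by simpa using h)
  have hmem := B.2
  rwa [hB] at hmem

theorem freeCumulant_nil {ι : Type*} (m : List ι → ℂ) : freeCumulant m [] = 0 := by
  rw [freeCumulant]; simp

open Classical in
/-- The moment-cumulant formula, which characterises the free cumulants. -/
theorem moment_cumulant_formula {ι : Type*} (m : List ι → ℂ) (w : List ι) (hw : w ≠ []) :
    m w = ∑ π ∈ ncPartitions w.length, ∏ B ∈ π.parts, freeCumulant m (wordRestrict w B) := by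
  have hne : (Finset.univ : Finset (Fin w.length)) ≠ ⊥ := by
    rw [Finset.bot_eq_empty]
    exact Finset.Nonempty.ne_empty ⟨⟨0, List.length_pos_iff.2 hw⟩, Finset.mem_univ _⟩
  have hparts : ∀ π : Finpartition (Finset.univ : Finset (Fin w.length)),
      Finset.univ ∈ π.parts → π = Finpartition.indiscrete hne := by
    intro π hπ
    refine Finpartition.ext ?_
    rw [Finpartition.indiscrete_parts]
    refine Finset.eq_singleton_iff_unique_mem.2 ⟨hπ, fun B hB => ?_⟩
    obtain ⟨x, hx⟩ := π.nonempty_of_mem_parts hB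
    exact π.eq_of_mem_parts hB hπ hx (Finset.mem_univ x)
  have hnc : Finpartition.indiscrete hne ∈ ncPartitions w.length := by
    simp only [ncPartitions, Finset.mem_filter, Finset.mem_univ, true_and]
    intro V hV W hW i j k l _ _ _ _ _ _ _
    simp only [Finpartition.indiscrete_parts, Finset.mem_singleton] at hV hW
    rw [hV, hW]
  have hsplit := Finset.sum_filter_add_sum_filter_not (ncPartitions w.length)
    (fun π => Finset.univ ∈ π.parts)
    (fun π => ∏ B ∈ π.parts, freeCumulant m (wordRestrict w B))
  have hone : (ncPartitions w.length).filter (fun π => Finset.univ ∈ π.parts)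
      = {Finpartition.indiscrete hne} := by
    ext π
    simp only [Finset.mem_filter, Finset.mem_singleton]
    constructor
    · exact fun h => hparts π h.2
    · rintro rfl
      exact ⟨hnc, by simp⟩
  rw [hone, Finset.sum_singleton, Finpartition.indiscrete_parts, Finset.prod_singleton,
    wordRestrict_univ] at hsplit
  rw [← hsplit, freeCumulant, if_neg hw]
  have hrest : ∑ π : {π : Finpartition (Finset.univ : Finset (Fin w.length)) //
        π ∈ ncPartitions w.length ∧ Finset.univ ∉ π.parts},
      ∏ B : {B : Finset (Fin w.length) // B ∈ π.1.parts}, freeCumulant m (wordRestrict w B.1)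
      = ∑ π ∈ (ncPartitions w.length).filter (fun π => ¬ Finset.univ ∈ π.parts),
        ∏ B ∈ π.parts, freeCumulant m (wordRestrict w B) := by
    rw [Finset.sum_subtype (p := fun π => π ∈ ncPartitions w.length ∧ Finset.univ ∉ π.parts)
      _ (fun π => by simp)]
    refine Finset.sum_congr rfl fun π _ => ?_
    exact (Finset.prod_subtype π.1.parts (fun B => Iff.rfl)
      (fun B => freeCumulant m (wordRestrict w B))).symm
  rw [hrest]
  ring

/-! ### Noncommutative probability spaces -/

/-- A unital linear functional on a complex unital algebra `A`. A noncommutative probability space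
is such an algebra together with such a functional. -/
structure UnitalFunctional (A : Type*) [Ring A] [Algebra ℂ A] where
  /-- The underlying linear functional. -/
  toLin : A →ₗ[ℂ] ℂ
  /-- The functional is unital. -/
  map_one : toLin 1 = 1

namespace UnitalFunctional

variable {A : Type*} [Ring A] [Algebra ℂ A]

/-- The moment series `M_a(z) = ∑_{n ≥ 1} φ(aⁿ) zⁿ` of an element `a`. -/
noncomputable def momentSeries (φ : UnitalFunctional A) (a : A) : PowerSeries ℂ :=
  PowerSeries.mk fun n => if n = 0 then 0 else φ.toLin (a ^ n)

/-- The `R`-transform `R_a(z) = ∑_{n ≥ 1} κₙ zⁿ` of an element `a`, where `κₙ` is the free cumulant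
`κₙ(a, …, a)`: free cumulants over a one-letter alphabet, words being identified with their
lengths. -/
noncomputable def rTransform (φ : UnitalFunctional A) (a : A) : PowerSeries ℂ :=
  PowerSeries.mk fun n =>
    freeCumulant (fun w : List Unit => φ.toLin (a ^ w.length)) (List.replicate n ())

/-- The moment-cumulant formula `φ(aⁿ) = ∑_{π ∈ NC(n)} ∏_{B ∈ π} κ_{|B|}(a)` for one element. -/
theorem moment_eq_sum_rTransform (φ : UnitalFunctional A) (a : A) (n : ℕ) (hn : n ≠ 0) :
    φ.toLin (a ^ n) =
      ∑ π ∈ ncPartitions n, ∏ B ∈ π.parts, PowerSeries.coeff B.card (φ.rTransform a) := by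
  have key : ∀ w : List Unit, w ≠ [] → φ.toLin (a ^ w.length) =
      ∑ π ∈ ncPartitions w.length, ∏ B ∈ π.parts,
        PowerSeries.coeff B.card (φ.rTransform a) := by
    intro w hw
    rw [moment_cumulant_formula (fun w : List Unit => φ.toLin (a ^ w.length)) w hw]
    refine Finset.sum_congr rfl fun π _ => Finset.prod_congr rfl fun B _ => ?_
    rw [rTransform, PowerSeries.coeff_mk, ← length_wordRestrict w B]
    congr 1
    exact List.eq_replicate_of_mem fun _ _ => rfl
  have h := key (List.replicate n ()) (by simpa using hn)
  rwa [List.length_replicate] at h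

/-- Freeness of two sets `S`, `T` with respect to `φ`: if `x₁, …, xₙ` (`n ≥ 1`) are elements with
`φ(xₖ) = 0`, taken alternately from the unital subalgebras generated by `S` and by `T`, then
`φ(x₁ ⋯ xₙ) = 0`. An element of the list is a pair `(i, x)`, where `i` tells which of the two
subalgebras `x` is taken from. -/
def AreFree (φ : UnitalFunctional A) (S T : Set A) : Prop :=
  ∀ l : List (Bool × A), l ≠ [] →
    (l.map Prod.fst).IsChain (· ≠ ·) →
    (∀ p ∈ l, p.2 ∈ Algebra.adjoin ℂ (if p.1 then S else T) ∧ φ.toLin p.2 = 0) →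
    φ.toLin (l.map Prod.snd).prod = 0

/-- Positivity of a functional on a `*`-algebra: `φ(x* x) ≥ 0` for all `x` (order on `ℂ`: the value
is real and nonnegative). -/
def IsPositive [StarRing A] (φ : UnitalFunctional A) : Prop :=
  ∀ x : A, 0 ≤ φ.toLin (star x * x)

end UnitalFunctional

/-! ### Algebraic `*`-distributions -/

/-- The two-letter alphabet `{1, *}`. -/
inductive StarLetter : Type
  | one
  | star

/-- The algebra `ℂ⟨Z, Z*⟩` of polynomials in two non-commuting indeterminates. -/
abbrev StarPoly : Type := FreeAlgebra ℂ StarLetter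

/-- An algebraic `*`-distribution: a linear functional on `ℂ⟨Z, Z*⟩` with `μ(1) = 1`. -/
abbrev StarDistribution : Type := UnitalFunctional StarPoly

/-- The monomial `Z^w`. -/
noncomputable def starMonomial (w : List StarLetter) : StarPoly :=
  (w.map (FreeAlgebra.ι ℂ)).prod

/-- The element `a^ℓ`, for a letter `ℓ ∈ {1, *}`. -/
def starPow {A : Type*} [Star A] (a : A) : StarLetter → A
  | .one => a
  | .star => star a

/-- The `*`-distribution of an element `a`: the functional `P ↦ φ(P(a, a*))` on `ℂ⟨Z, Z*⟩`. -/
noncomputable def UnitalFunctional.starDistribution {A : Type*} [Ring A] [Algebra ℂ A] [Star A]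
    (φ : UnitalFunctional A) (a : A) : StarDistribution where
  toLin := φ.toLin ∘ₗ (FreeAlgebra.lift ℂ (starPow a)).toLinearMap
  map_one := by simp [φ.map_one]

namespace StarDistribution

/-- The coefficients `Cf_w(R_μ)` of the `R`-transform of a `*`-distribution `μ`. -/
noncomputable def rCoeff (μ : StarDistribution) : List StarLetter → ℂ :=
  freeCumulant fun w => μ.toLin (starMonomial w)

/-- The word `(1,*)ⁿ`. -/
def altOneStar (n : ℕ) : List StarLetter :=
  (List.replicate n [StarLetter.one, StarLetter.star]).flatten

/-- The word `(*,1)ⁿ`. -/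
def altStarOne (n : ℕ) : List StarLetter :=
  (List.replicate n [StarLetter.star, StarLetter.one]).flatten

/-- A word is alternating if it is `(1,*)ⁿ` or `(*,1)ⁿ` for some `n ≥ 1`. -/
def IsAlternating (w : List StarLetter) : Prop :=
  ∃ n : ℕ, 1 ≤ n ∧ (w = altOneStar n ∨ w = altStarOne n)

/-- `μ` is `R`-diagonal if the coefficients of its `R`-transform vanish on all nonempty words which
are not alternating. -/
def IsRDiagonal (μ : StarDistribution) : Prop :=
  ∀ w : List StarLetter, w ≠ [] → ¬ IsAlternating w → μ.rCoeff w = 0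

/-- The first determining sequence of an `R`-diagonal distribution: `αₙ` is the coefficient of
`(z z*)ⁿ` in `R_μ`, for `n ≥ 1` (and `α₀ = 0`). -/
noncomputable def alpha (μ : StarDistribution) (n : ℕ) : ℂ := μ.rCoeff (altOneStar n)

/-- The second determining sequence of an `R`-diagonal distribution: `βₙ` is the coefficient of
`(z* z)ⁿ` in `R_μ`, for `n ≥ 1` (and `β₀ = 0`). -/
noncomputable def beta (μ : StarDistribution) (n : ℕ) : ℂ := μ.rCoeff (altStarOne n)

theorem alpha_zero (μ : StarDistribution) : μ.alpha 0 = 0 := freeCumulant_nil _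

theorem beta_zero (μ : StarDistribution) : μ.beta 0 = 0 := freeCumulant_nil _

end StarDistribution

/-- `ν = μ ⊠ μ'`: there are elements `x`, `x'` of a `C*`-probability space with `*`-distributions
`μ` and `μ'`, such that `{x, x*}` is free from `{x', (x')*}` and `ν` is the `*`-distribution of
`x x'`. In particular `μ`, `μ'` and `ν` are then `*`-distributions of elements of a
`C*`-probability space. -/
def IsFreeMulConv (μ μ' ν : StarDistribution) : Prop :=
  ∃ (B : Type u) (_ : CStarAlgebra B) (ψ : UnitalFunctional B) (x x' : B),
    ψ.IsPositive ∧
    ψ.AreFree {x, star x} {x', star x'} ∧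
    ψ.starDistribution x = μ ∧
    ψ.starDistribution x' = μ' ∧
    ψ.starDistribution (x * x') = ν

/-! ### Composition of power series -/

/-- The composition `f ∘ g = f(g(z))` of formal power series; `g` has to have vanishing constant
coefficient. -/
noncomputable def seriesComp (f g : PowerSeries ℂ) : PowerSeries ℂ := PowerSeries.subst g f

open Classical in
/-- The inverse of `f` relative to composition, for a series `f` with vanishing constant
coefficient and nonvanishing linear coefficient. -/
noncomputable def seriesCompInv (f : PowerSeries ℂ) : PowerSeries ℂ :=
  if h : IsUnit (PowerSeries.coeff 1 f) then f.substInvOfIsUnit h else 0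

theorem seriesComp_compInv (f : PowerSeries ℂ) (h0 : PowerSeries.constantCoeff f = 0)
    (h1 : PowerSeries.coeff 1 f ≠ 0) :
    seriesComp f (seriesCompInv f) = PowerSeries.X ∧
      seriesComp (seriesCompInv f) f = PowerSeries.X := by
  simp only [seriesComp, seriesCompInv, dif_pos h1.isUnit]
  exact ⟨PowerSeries.subst_substInvOfIsUnit_right f h0 _,
    PowerSeries.subst_substInvOfIsUnit_left f h0 _⟩

/-!
The moments of a tuple `x` are encoded by the expectation `W` of the resolvent of a linear pencil
`∑ x_l ⊗ Λ_l`, whose coefficients `Λ_l` are scalar matrices. The coefficients lie in `F 1` of a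
`NilFiltration`, so that every series is a finite sum and formal power series, also in non-commuting
indeterminates, may be evaluated at them; sufficiently large matrices (`letterMatrix`) recover each
single moment or cumulant. Three facts about such pencils carry the proof.

* *Functional equation.* Splitting a non-crossing partition along the block of its first letter gives
  `moment_cons_eq_gapSum`, and hence `W = 1 + R(Λ W)` for the `R`-transform `R` of the tuple
  (`NilFiltration.wordSum_moment`).
* *Additivity.* For two free tuples `W = 1 + R(Λ W) + R'(Λ' W)` (`expect_resolvent_of_areFree`). The
  resolvent of the sum of the pencils is an alternating series in the centred resolvents of the two
  shifted pencils, and freeness kills the expectation of its nonconstant terms.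
* *Linearisation.* With orthogonal idempotents as places between the letters, a product of two
  elements turns into a corner of the resolvent of a linear pencil (`resolvent_corner`,
  `resolvent_corner_two`).

Applied to `b a'`, they show that `θ = z ∑ φ(a' (b a')ᵏ) zᵏ` and `η = z ∑ φ(b (a' b)ᵏ) zᵏ` satisfy
`M_{ba'} = R_b ∘ θ`, `M_{a'b} = R_{a'} ∘ η` and the subordination equations
`θ = z (A₁ ∘ η) (1 + R_b ∘ θ)`, `η = z (B₁ ∘ θ) (1 + R_{a'} ∘ η)`, where `R_{a'} = z A₁` and `R_b = z B₁`
(`momentSeries_mul_of_areFree`). Thus `θ = R_b⁻¹ ∘ M_{ba'}` and `η = R_{a'}⁻¹ ∘ M_{a'b}`, the inverses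
being relative to composition.

For the product `x x'` of `R`-diagonal elements, the `R`-transforms in the functional equation of the
pencil of `x`, `x*`, `x'`, `x'*` only involve the two alternating arguments of each element. In the
corner of `x x'` these arguments solve a matrix version of the same subordination equations
(`NilFiltration.subordination_of_block`); a contraction argument shows that they are `θ` and `η`,
evaluated at the alternating arguments of `x x'` (`NilFiltration.subordination_unique`). So `x x'`
satisfies the functional equation of the `R`-diagonal distribution with determining series `R_a ∘ θ`
and `R_{b'} ∘ η`. As that equation has one solution (`NilFiltration.corner_unique`), and every
sequence is the sequence of free cumulants of some moments (`freeCumulant_ncMoment`), these are the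
free cumulants of `x x'` (`rCoeff_mul_of_areFree`).
-/

namespace FreeProduct

open Finset

/-! ### Non-crossing partitions of finite sets of natural numbers -/

/-- `P` is (the set of blocks of) a non-crossing partition of the finite set `S` of positions. -/
structure IsNCPart (S : Finset ℕ) (P : Finset (Finset ℕ)) : Prop where
  subset : ∀ V ∈ P, V ⊆ S
  nonempty : ∀ V ∈ P, V.Nonempty
  eq_of_mem : ∀ V ∈ P, ∀ W ∈ P, ∀ i, i ∈ V → i ∈ W → V = W
  exists_mem : ∀ i ∈ S, ∃ V ∈ P, i ∈ V
  noncrossing : ∀ V ∈ P, ∀ W ∈ P, ∀ i j k l : ℕ, i < j → j < k → k < l →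
    i ∈ V → k ∈ V → j ∈ W → l ∈ W → V = W

open Classical in
/-- The non-crossing partitions of a finite set of positions. -/
noncomputable def ncSets (S : Finset ℕ) : Finset (Finset (Finset ℕ)) :=
  S.powerset.powerset.filter (IsNCPart S)

theorem mem_ncSets {S : Finset ℕ} {P : Finset (Finset ℕ)} : P ∈ ncSets S ↔ IsNCPart S P := by
  simp only [ncSets, mem_filter, mem_powerset, and_iff_right_iff_imp]
  exact fun h V hV => mem_powerset.2 (h.subset V hV)

/-- The sum over the non-crossing partitions of `S` of the products of block weights `f`. -/
noncomputable def ncSum (f : Finset ℕ → ℂ) (S : Finset ℕ) : ℂ :=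
  ∑ P ∈ ncSets S, ∏ B ∈ P, f B

theorem IsNCPart.union {S T U : Finset ℕ} (hS : S = T ∪ U) (hdisj : Disjoint T U)
    (hconv : ∀ i ∈ T, ∀ k ∈ T, ∀ j ∈ U, i < j → j < k → False)
    {P Q : Finset (Finset ℕ)} (hP : IsNCPart T P) (hQ : IsNCPart U Q) : IsNCPart S (P ∪ Q) where
  subset V hV := by
    subst hS
    rcases mem_union.1 hV with h | h
    · exact (hP.subset V h).trans subset_union_left
    · exact (hQ.subset V h).trans subset_union_right
  nonempty V hV := (mem_union.1 hV).elim (hP.nonempty V) (hQ.nonempty V)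
  eq_of_mem V hV W hW i hi hi' := by
    rcases mem_union.1 hV with h | h <;> rcases mem_union.1 hW with h' | h'
    · exact hP.eq_of_mem V h W h' i hi hi'
    · exact (disjoint_left.1 hdisj (hP.subset V h hi) (hQ.subset W h' hi')).elim
    · exact (disjoint_left.1 hdisj (hP.subset W h' hi') (hQ.subset V h hi)).elim
    · exact hQ.eq_of_mem V h W h' i hi hi'
  exists_mem i hi := by
    subst hS
    rcases mem_union.1 hi with h | h
    · obtain ⟨V, hV, hiV⟩ := hP.exists_mem i h
      exact ⟨V, mem_union_left _ hV, hiV⟩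
    · obtain ⟨V, hV, hiV⟩ := hQ.exists_mem i h
      exact ⟨V, mem_union_right _ hV, hiV⟩
  noncrossing V hV W hW i j k l hij hjk hkl hi hk hj hl := by
    rcases mem_union.1 hV with h | h <;> rcases mem_union.1 hW with h' | h'
    · exact hP.noncrossing V h W h' i j k l hij hjk hkl hi hk hj hl
    · exact (hconv i (hP.subset V h hi) k (hP.subset V h hk) j (hQ.subset W h' hj) hij hjk).elim
    · exact (hconv j (hP.subset W h' hj) l (hP.subset W h' hl) k (hQ.subset V h hk) hjk hkl).elim
    · exact hQ.noncrossing V h W h' i j k l hij hjk hkl hi hk hj hl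

theorem IsNCPart.filter_subset {S T U : Finset ℕ} (hS : S = T ∪ U) (hdisj : Disjoint T U)
    {P : Finset (Finset ℕ)} (hP : IsNCPart S P) (hsat : ∀ V ∈ P, V ⊆ T ∨ V ⊆ U) :
    IsNCPart T (P.filter (· ⊆ T)) where
  subset V hV := (mem_filter.1 hV).2
  nonempty V hV := hP.nonempty V (mem_filter.1 hV).1
  eq_of_mem V hV W hW := hP.eq_of_mem V (mem_filter.1 hV).1 W (mem_filter.1 hW).1
  exists_mem i hi := by
    obtain ⟨V, hV, hiV⟩ := hP.exists_mem i (hS ▸ mem_union_left _ hi)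
    refine ⟨V, mem_filter.2 ⟨hV, ?_⟩, hiV⟩
    exact (hsat V hV).resolve_right fun h => disjoint_left.1 hdisj hi (h hiV)
  noncrossing V hV W hW := hP.noncrossing V (mem_filter.1 hV).1 W (mem_filter.1 hW).1

/-- If `T` is an interval of `S`, the non-crossing partitions of `S` in which `T` is a union of
blocks are the pairs of non-crossing partitions of `T` and of `S \ T`. -/
theorem sum_filter_ncSets_split (f : Finset ℕ → ℂ) {S T U : Finset ℕ} (hS : S = T ∪ U)
    (hdisj : Disjoint T U)
    (hconv : ∀ i ∈ T, ∀ k ∈ T, ∀ j ∈ U, i < j → j < k → False)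
    (p q : Finset (Finset ℕ) → Prop) [DecidablePred p] [DecidablePred q]
    (hp : ∀ P, IsNCPart S P → p P → (∀ V ∈ P, V ⊆ T ∨ V ⊆ U) ∧ q (P.filter (· ⊆ U)))
    (hq : ∀ P Q, IsNCPart T P → IsNCPart U Q → q Q → p (P ∪ Q)) :
    ∑ P ∈ (ncSets S).filter p, ∏ B ∈ P, f B =
      ncSum f T * ∑ P ∈ (ncSets U).filter q, ∏ B ∈ P, f B := by
  have hne : ∀ {V : Finset ℕ}, V.Nonempty → V ⊆ T → V ⊆ U → False := by
    rintro V ⟨x, hx⟩ h1 h2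
    exact disjoint_left.1 hdisj (h1 hx) (h2 hx)
  rw [ncSum, sum_mul_sum, ← sum_product']
  refine sum_nbij' (fun P => (P.filter (· ⊆ T), P.filter (· ⊆ U))) (fun Q => Q.1 ∪ Q.2)
    ?_ ?_ ?_ ?_ ?_
  · intro P hP
    obtain ⟨h1, h2⟩ := mem_filter.1 hP
    rw [mem_ncSets] at h1
    obtain ⟨h3, h4⟩ := hp P h1 h2
    refine mem_product.2 ⟨mem_ncSets.2 (h1.filter_subset hS hdisj h3),
      mem_filter.2 ⟨mem_ncSets.2 (h1.filter_subset (hS.trans (union_comm _ _)) hdisj.symm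
        fun V hV => (h3 V hV).symm), h4⟩⟩
  · rintro ⟨P, Q⟩ hPQ
    obtain ⟨h1, h2⟩ := mem_product.1 hPQ
    obtain ⟨h2, h3⟩ := mem_filter.1 h2
    rw [mem_ncSets] at h1 h2
    exact mem_filter.2 ⟨mem_ncSets.2 (h1.union hS hdisj hconv h2), hq P Q h1 h2 h3⟩
  · intro P hP
    obtain ⟨h1, h2⟩ := mem_filter.1 hP
    rw [mem_ncSets] at h1
    obtain ⟨h3, -⟩ := hp P h1 h2
    ext V
    simp only [mem_union, mem_filter]
    constructor
    · rintro (h | h) <;> exact h.1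
    · intro h
      exact (h3 V h).imp (⟨h, ·⟩) (⟨h, ·⟩)
  · rintro ⟨P, Q⟩ hPQ
    obtain ⟨h1, h2⟩ := mem_product.1 hPQ
    obtain ⟨h2, h3⟩ := mem_filter.1 h2
    rw [mem_ncSets] at h1 h2
    ext V
    · simp only [mem_union, mem_filter]
      constructor
      · rintro ⟨h | h, h'⟩
        · exact h
        · exact (hne (h2.nonempty V h) h' (h2.subset V h)).elim
      · exact fun h => ⟨Or.inl h, h1.subset V h⟩
    · simp only [mem_union, mem_filter]
      constructor
      · rintro ⟨h | h, h'⟩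
        · exact (hne (h1.nonempty V h) (h1.subset V h) h').elim
        · exact h
      · exact fun h => ⟨Or.inr h, h2.subset V h⟩
  · intro P hP
    obtain ⟨h1, h2⟩ := mem_filter.1 hP
    rw [mem_ncSets] at h1
    obtain ⟨h3, -⟩ := hp P h1 h2
    rw [← prod_union]
    · congr 1
      ext V
      simp only [mem_union, mem_filter]
      constructor
      · intro h
        exact (h3 V h).imp (⟨h, ·⟩) (⟨h, ·⟩)
      · rintro (h | h) <;> exact h.1
    · rw [disjoint_left]
      intro V hV hV'
      rw [mem_filter] at hV hV'
      exact hne (h1.nonempty V hV.1) hV.2 hV'.2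

/-- Transport of the sum over `NC(n)`, `n = |v|`, to the non-crossing partitions of an interval of
positions that carries the word `v`. -/
theorem sum_ncPartitions_eq_ncSum {ι : Type*} (κ : List ι → ℂ) (w : ℕ → ι) (a n : ℕ) (v : List ι)
    (hv : v = (List.range' a n).map w) :
    ∑ π ∈ ncPartitions v.length, ∏ B ∈ π.parts, κ (wordRestrict v B) =
      ncSum (fun B => κ ((B.sort (· ≤ ·)).map w)) (Ico a (a + n)) := by
  classical
  have hlen : v.length = n := by simp [hv]
  let e : Fin v.length ↪ ℕ := ⟨fun i => a + i, fun i j h => Fin.ext (by simpa using h)⟩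
  have he : ∀ i, e i = a + i := fun i => rfl
  have hmono : StrictMono e := fun i j h => by
    rw [he, he]; exact Nat.add_lt_add_left h a
  have hword : ∀ B : Finset (Fin v.length),
      wordRestrict v B = ((B.map e).sort (· ≤ ·)).map w := by
    intro B
    have h1 : (B.map e).sort (· ≤ ·) = (B.sort (· ≤ ·)).map e := by
      refine List.Perm.eq_of_pairwise (le := (· ≤ ·)) (fun a b _ _ h h' => le_antisymm h h') ?_ ?_ ?_
      · exact Finset.pairwise_sort _ _
      · rw [List.pairwise_map]
        exact (Finset.pairwise_sort B (· ≤ ·)).imp fun h => hmono.monotone h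
      · refine (List.perm_ext_iff_of_nodup (Finset.sort_nodup _ _)
          ((Finset.sort_nodup _ _).map e.injective)).2 fun x => ?_
        simp
    rw [h1, List.map_map, wordRestrict]
    refine List.map_congr_left fun i _ => ?_
    subst hv
    simp [he]
  have hrange : ∀ x, x ∈ Ico a (a + n) → ∃ i, e i = x := by
    intro x hx
    rw [mem_Ico] at hx
    exact ⟨⟨x - a, by omega⟩, by rw [he]; simp; omega⟩
  have heI : ∀ i, e i ∈ Ico a (a + n) := by
    intro i
    rw [he, mem_Ico]
    have := i.2
    omega
  have hinj : Function.Injective (Finset.map e) := Finset.map_injective e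
  refine sum_bij (fun π _ => π.parts.image (Finset.map e)) ?_ ?_ ?_ ?_
  · intro π hπ
    rw [mem_ncSets]
    rw [ncPartitions, mem_filter] at hπ
    have hnc := hπ.2
    constructor
    · intro V hV x hx
      obtain ⟨B, hB, rfl⟩ := mem_image.1 hV
      obtain ⟨i, _, rfl⟩ := mem_map.1 hx
      exact heI i
    · intro V hV
      obtain ⟨B, hB, rfl⟩ := mem_image.1 hV
      exact (π.nonempty_of_mem_parts hB).map
    · intro V hV W hW x hx hx'
      obtain ⟨B, hB, rfl⟩ := mem_image.1 hV
      obtain ⟨C, hC, rfl⟩ := mem_image.1 hW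
      obtain ⟨i, hi, rfl⟩ := mem_map.1 hx
      rw [mem_map' e] at hx'
      rw [π.eq_of_mem_parts hB hC hi hx']
    · intro x hx
      obtain ⟨i, rfl⟩ := hrange x hx
      obtain ⟨B, hB, hi⟩ := π.exists_mem (mem_univ i)
      exact ⟨B.map e, mem_image_of_mem _ hB, mem_map_of_mem _ hi⟩
    · intro V hV W hW i j k l hij hjk hkl hi hk hj hl
      obtain ⟨B, hB, rfl⟩ := mem_image.1 hV
      obtain ⟨C, hC, rfl⟩ := mem_image.1 hW
      obtain ⟨i, hi', rfl⟩ := mem_map.1 hi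
      obtain ⟨j, hj', rfl⟩ := mem_map.1 hj
      obtain ⟨k, hk', rfl⟩ := mem_map.1 hk
      obtain ⟨l, hl', rfl⟩ := mem_map.1 hl
      rw [hnc B hB C hC i j k l (hmono.lt_iff_lt.1 hij) (hmono.lt_iff_lt.1 hjk)
        (hmono.lt_iff_lt.1 hkl) hi' hk' hj' hl']
  · intro π _ π' _ h
    exact Finpartition.ext (image_injective hinj h)
  · intro P hP
    rw [mem_ncSets] at hP
    have hVe : ∀ V ∈ P, (univ.filter (fun i => e i ∈ V)).map e = V := by
      intro V hV
      ext x
      simp only [mem_map, mem_filter, mem_univ, true_and]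
      constructor
      · rintro ⟨i, hi, rfl⟩
        exact hi
      · intro hx
        obtain ⟨i, rfl⟩ := hrange x (hP.subset V hV hx)
        exact ⟨i, hx, rfl⟩
    refine ⟨Finpartition.ofExistsUnique (P.image fun V => univ.filter (fun i => e i ∈ V))
      (fun _ _ => subset_univ _) ?_ ?_, ?_, ?_⟩
    · intro i _
      obtain ⟨V, hV, hi⟩ := hP.exists_mem (e i) (heI i)
      refine ⟨univ.filter (fun i => e i ∈ V), ⟨mem_image_of_mem _ hV, by simpa using hi⟩, ?_⟩
      rintro B ⟨hB, hi'⟩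
      obtain ⟨W, hW, rfl⟩ := mem_image.1 hB
      rw [hP.eq_of_mem V hV W hW (e i) hi (by simpa using hi')]
    · intro h
      obtain ⟨V, hV, h⟩ := mem_image.1 h
      have h2 := hVe V hV
      rw [h, map_empty] at h2
      exact (hP.nonempty V hV).ne_empty h2.symm
    · simp only [ncPartitions, mem_filter, mem_univ, true_and]
      intro B hB C hC i j k l hij hjk hkl hi hk hj hl
      obtain ⟨V, hV, rfl⟩ := mem_image.1 hB
      obtain ⟨W, hW, rfl⟩ := mem_image.1 hC
      simp only [mem_filter, mem_univ, true_and] at hi hj hk hl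
      rw [hP.noncrossing V hV W hW _ _ _ _ (hmono hij) (hmono hjk) (hmono hkl) hi hk hj hl]
    · ext V
      simp only [Finpartition.ofExistsUnique, mem_image, exists_exists_and_eq_and]
      constructor
      · rintro ⟨W, hW, rfl⟩
        rwa [hVe W hW]
      · exact fun hV => ⟨V, hV, hVe V hV⟩
  · intro π _
    rw [prod_image fun _ _ _ _ h => hinj h]
    exact prod_congr rfl fun B _ => by rw [hword]

/-! ### The first-block recursion -/

/-- The sum over the ways of completing a block of a non-crossing partition of a word: `c` is the
part of the block read so far, `p` the word read since its last letter, and `v` is still unread.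
Each gap of the block contributes its moment `m`, the block itself its weight `κ`. -/
def gapSum {ι : Type*} (κ m : List ι → ℂ) : List ι → List ι → List ι → ℂ
  | c, p, [] => κ c * m p
  | c, p, l :: v => m p * gapSum κ m (c ++ [l]) [] v + gapSum κ m c (p ++ [l]) v

open Classical in
/-- The part of the sum over the non-crossing partitions of `C ∪ [a, n)` in which some block contains
`C` and avoids `[a, b)`. -/
noncomputable def blockSum (f : Finset ℕ → ℂ) (C : Finset ℕ) (a b n : ℕ) : ℂ :=
  ∑ P ∈ (ncSets (C ∪ Ico a n)).filter (fun P => ∃ V ∈ P, C ⊆ V ∧ ∀ i ∈ Ico a b, i ∉ V),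
    ∏ B ∈ P, f B

theorem ncSets_self_filter {C : Finset ℕ} (hC : C.Nonempty) (P : Finset (Finset ℕ)) :
    (IsNCPart C P ∧ C ∈ P) ↔ P = {C} := by
  constructor
  · rintro ⟨hP, hCP⟩
    refine eq_singleton_iff_unique_mem.2 ⟨hCP, fun V hV => ?_⟩
    obtain ⟨x, hx⟩ := hP.nonempty V hV
    exact hP.eq_of_mem V hV C hCP x hx (hP.subset V hV hx)
  · rintro rfl
    refine ⟨⟨by simp, by simpa using hC, by simp, fun i hi => ⟨C, by simp, hi⟩, ?_⟩, by simp⟩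
    intro V hV W hW _ _ _ _ _ _ _ _ _ _ _
    rw [mem_singleton.1 hV, mem_singleton.1 hW]

theorem blockSum_self (f : Finset ℕ → ℂ) {C : Finset ℕ} (hC : C.Nonempty) {a n : ℕ}
    (ha : ∀ i ∈ C, i < a) : blockSum f C a n n = f C * ncSum f (Ico a n) := by
  classical
  have hdisj : Disjoint (Ico a n) C := by
    rw [disjoint_left]
    intro x hx hx'
    have := ha x hx'
    rw [mem_Ico] at hx
    omega
  rw [blockSum, sum_filter_ncSets_split f (union_comm C (Ico a n)) hdisj ?_
    (fun P => ∃ V ∈ P, C ⊆ V ∧ ∀ i ∈ Ico a n, i ∉ V) (fun P => C ∈ P) ?_ ?_]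
  · have h1 : (ncSets C).filter (fun P => C ∈ P) = {{C}} := by
      ext P
      rw [mem_filter, mem_ncSets, ncSets_self_filter hC, mem_singleton]
    rw [h1, sum_singleton, prod_singleton, mul_comm]
  · intro i hi k _ j hj hij _
    have := ha j hj
    rw [mem_Ico] at hi
    omega
  · rintro P hP ⟨V, hV, hCV, hVa⟩
    have hVC : V = C := by
      refine Subset.antisymm (fun x hx => ?_) hCV
      rcases mem_union.1 (hP.subset V hV hx) with h | h
      · exact h
      · exact (hVa x h hx).elim
    subst hVC
    refine ⟨fun W hW => ?_, by simpa using hV⟩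
    by_cases hWV : W = V
    · exact Or.inr hWV.subset
    · left
      intro x hx
      rcases mem_union.1 (hP.subset W hW hx) with h | h
      · exact (hWV (hP.eq_of_mem W hW V hV x hx h)).elim
      · exact h
  · intro P Q _ _ hCQ
    exact ⟨C, mem_union_right _ hCQ, subset_rfl, fun i hi hi' => disjoint_left.1 hdisj hi hi'⟩

/-- The block that contains `C` and avoids `[a, b)` either contains `b`, and then `[a, b)` is a gap of
the block and is partitioned on its own, or avoids `[a, b]`. -/
theorem blockSum_step (f : Finset ℕ → ℂ) {C : Finset ℕ} (hC : C.Nonempty) {a b n : ℕ}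
    (ha : ∀ i ∈ C, i < a) (hab : a ≤ b) (hbn : b < n) :
    blockSum f C a b n =
      ncSum f (Ico a b) * blockSum f (insert b C) (b + 1) (b + 1) n + blockSum f C a (b + 1) n := by
  classical
  obtain ⟨c, hc⟩ := hC
  rw [blockSum, ← sum_filter_add_sum_filter_not _
    (fun P => ∃ V ∈ P, C ⊆ V ∧ (∀ i ∈ Ico a b, i ∉ V) ∧ b ∈ V)]
  have huniq : ∀ P, IsNCPart (C ∪ Ico a n) P → ∀ V ∈ P, ∀ W ∈ P, C ⊆ V → C ⊆ W → V = W :=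
    fun P hP V hV W hW h1 h2 => hP.eq_of_mem V hV W hW c (h1 hc) (h2 hc)
  congr 1
  · rw [filter_filter, blockSum]
    have hdisj : Disjoint (Ico a b) (insert b C ∪ Ico (b + 1) n) := by
      rw [disjoint_left]
      intro x hx hx'
      rw [mem_Ico] at hx
      rw [mem_union, mem_insert, mem_Ico] at hx'
      rcases hx' with (h | h) | h
      · omega
      · have := ha x h; omega
      · omega
    have hU : C ∪ Ico a n = Ico a b ∪ (insert b C ∪ Ico (b + 1) n) := by
      ext x
      simp only [mem_union, mem_insert, mem_Ico]
      constructor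
      · rintro (h | h)
        · exact Or.inr (Or.inl (Or.inr h))
        · omega
      · rintro (h | (h | h) | h)
        · omega
        · omega
        · exact Or.inl h
        · omega
    have key := sum_filter_ncSets_split f hU hdisj ?_
      (fun P => (∃ V ∈ P, C ⊆ V ∧ ∀ i ∈ Ico a b, i ∉ V) ∧
        ∃ V ∈ P, C ⊆ V ∧ (∀ i ∈ Ico a b, i ∉ V) ∧ b ∈ V)
      (fun P => ∃ V ∈ P, insert b C ⊆ V ∧ ∀ i ∈ Ico (b + 1) (b + 1), i ∉ V) ?_ ?_
    · convert key
    · intro i hi k hk j hj hij hjk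
      refine disjoint_left.1 hdisj ?_ hj
      rw [mem_Ico] at hi hk ⊢
      omega
    · rintro P hP ⟨-, V, hV, hCV, hVa, hbV⟩
      have hVU : V ⊆ insert b C ∪ Ico (b + 1) n := by
        intro x hx
        rcases mem_union.1 (hU ▸ hP.subset V hV hx) with h | h
        · exact (hVa x h hx).elim
        · exact h
      refine ⟨fun W hW => ?_, V, mem_filter.2 ⟨hV, hVU⟩, insert_subset hbV hCV, by simp⟩
      by_cases hWV : W = V
      · exact Or.inr (hWV ▸ hVU)
      by_cases hWT : ∃ x ∈ W, x ∈ Ico a b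
      · left
        obtain ⟨x, hxW, hx⟩ := hWT
        intro y hy
        rcases mem_union.1 (hU ▸ hP.subset W hW hy) with h | h
        · exact h
        exfalso
        rw [mem_union, mem_insert] at h
        rcases h with (rfl | h) | h
        · exact hWV (hP.eq_of_mem W hW V hV y hy hbV)
        · exact hWV (hP.eq_of_mem W hW V hV y hy (hCV h))
        · have h1 := ha c hc
          rw [mem_Ico] at h hx
          -- the blocks `V ∋ c, b` and `W ∋ x, y` cross, as `c < x < b < y`
          exact hWV (hP.noncrossing V hV W hW c x b y (by omega) hx.2 (by omega)
            (hCV hc) hbV hxW hy).symm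
      · right
        intro y hy
        rcases mem_union.1 (hU ▸ hP.subset W hW hy) with h | h
        · exact (hWT ⟨y, hy, h⟩).elim
        · exact h
    · rintro P Q hP hQ ⟨V, hV, hCV, -⟩
      have hVa : ∀ i ∈ Ico a b, i ∉ V := fun i hi hi' => disjoint_left.1 hdisj hi (hQ.subset V hV hi')
      have hCV' : C ⊆ V := (subset_insert b C).trans hCV
      exact ⟨⟨V, mem_union_right _ hV, hCV', hVa⟩,
        V, mem_union_right _ hV, hCV', hVa, hCV (mem_insert_self b C)⟩
  · rw [filter_filter, blockSum]
    congr 1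
    ext P
    simp only [mem_filter, and_congr_right_iff]
    intro hP
    rw [mem_ncSets] at hP
    constructor
    · rintro ⟨⟨V, hV, hCV, hVa⟩, h2⟩
      refine ⟨V, hV, hCV, fun i hi hiV => ?_⟩
      rw [mem_Ico] at hi
      by_cases hib : i = b
      · exact h2 ⟨V, hV, hCV, hVa, hib ▸ hiV⟩
      · exact hVa i (mem_Ico.2 ⟨hi.1, by omega⟩) hiV
    · rintro ⟨V, hV, hCV, hVa⟩
      refine ⟨⟨V, hV, hCV, fun i hi => hVa i (Ico_subset_Ico_right (Nat.le_succ b) hi)⟩, ?_⟩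
      rintro ⟨W, hW, hCW, -, hbW⟩
      obtain rfl := huniq P hP W hW V hV hCW hCV
      exact hVa b (mem_Ico.2 ⟨hab, Nat.lt_succ_self b⟩) hbW

/-- `blockSum` obeys the recursion that defines `gapSum`. Here `C` is the part of the block read so far,
`[a, a + k)` the current gap, and `r` the number of positions still unread. -/
theorem blockSum_eq_gapSum {ι : Type*} (κ m : List ι → ℂ) (w : ℕ → ι) {n : ℕ}
    (hm : ∀ a k, a + k ≤ n → m ((List.range' a k).map w) =
      ncSum (fun B => κ ((B.sort (· ≤ ·)).map w)) (Ico a (a + k))) (r : ℕ) :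
    ∀ (C : Finset ℕ) (a k : ℕ), C.Nonempty → (∀ i ∈ C, i < a) → a + k + r = n →
      blockSum (fun B => κ ((B.sort (· ≤ ·)).map w)) C a (a + k) n =
        gapSum κ m ((C.sort (· ≤ ·)).map w) ((List.range' a k).map w)
          ((List.range' (a + k) r).map w) := by
  induction r with
  | zero =>
    intro C a k hC ha hn
    obtain rfl : a + k = n := hn
    rw [blockSum_self _ hC ha, ← hm a k le_rfl]
    simp [gapSum]
  | succ r ih =>
    intro C a k hC ha hn
    have hsort : ((insert (a + k) C).sort (· ≤ ·)) = C.sort (· ≤ ·) ++ [a + k] := by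
      have hlt : ∀ x ∈ C, x < a + k := fun x hx => (ha x hx).trans_le (Nat.le_add_right a k)
      refine List.Perm.eq_of_pairwise (le := (· ≤ ·)) (fun a b _ _ h h' => le_antisymm h h') ?_ ?_ ?_
      · exact Finset.pairwise_sort _ _
      · rw [List.pairwise_append]
        refine ⟨Finset.pairwise_sort _ _, by simp, fun x hx y hy => ?_⟩
        rw [List.mem_singleton.1 hy]
        exact (hlt x ((mem_sort _).1 hx)).le
      · refine (List.perm_ext_iff_of_nodup (Finset.sort_nodup _ _) ?_).2 fun x => ?_
        · rw [List.nodup_append]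
          refine ⟨Finset.sort_nodup _ _, by simp, fun x hx y hy => ?_⟩
          rw [List.mem_singleton.1 hy]
          exact (hlt x ((mem_sort _).1 hx)).ne
        · simp [or_comm]
    rw [blockSum_step _ hC ha (Nat.le_add_right a k) (by omega), List.range'_succ, List.map_cons,
      gapSum, ← hm a k (by omega)]
    congr 1
    · have h1 := ih (insert (a + k) C) (a + k + 1) 0 (insert_nonempty _ _) (fun i hi => by
        rcases mem_insert.1 hi with h | h
        · omega
        · have := ha i h; omega) (by omega)
      rw [hsort] at h1
      simp only [Nat.add_zero, List.range'_zero, List.map_nil, List.map_append, List.map_cons] at h1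
      rw [h1]
    · have h2 := ih C a (k + 1) hC ha (by omega)
      rw [List.range'_concat, List.map_append] at h2
      simpa [Nat.add_assoc] using h2

/-- **First-block recursion.** A moment is the sum over the blocks that contain the first letter. -/
theorem moment_cons_eq_gapSum {ι : Type*} (m : List ι → ℂ) (hm1 : m [] = 1) (l : ι) (v : List ι) :
    m (l :: v) = gapSum (freeCumulant m) m [l] [] v := by
  classical
  let w : ℕ → ι := fun i => (l :: v).getD i l
  have hw : ∀ a k, a + k ≤ (l :: v).length → m ((List.range' a k).map w) =
      ncSum (fun B => freeCumulant m ((B.sort (· ≤ ·)).map w)) (Ico a (a + k)) := by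
    intro a k _
    rcases Nat.eq_zero_or_pos k with rfl | hk
    · have h1 : ncSets ∅ = {∅} := by
        ext P
        rw [mem_ncSets, mem_singleton]
        constructor
        · intro hP
          refine eq_empty_of_forall_notMem fun V hV => ?_
          obtain ⟨x, hx⟩ := hP.nonempty V hV
          exact notMem_empty x (hP.subset V hV hx)
        · rintro rfl
          constructor <;> simp
      simp [hm1, ncSum, h1]
    · rw [moment_cumulant_formula m _ (by simp; omega)]
      exact sum_ncPartitions_eq_ncSum _ w a k _ rfl
  have hword : ∀ j (u : List ι), (l :: v).drop j = u → (List.range' j u.length).map w = u := by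
    intro j u hu
    refine List.ext_getElem (by simp) fun i h1 h2 => ?_
    subst hu
    rw [List.length_drop] at h2
    simp only [List.getElem_map, List.getElem_range', List.getElem_drop, w, one_mul]
    rw [List.getD_eq_getElem _ _ (by omega)]
  have h0 : m (l :: v) = ncSum (fun B => freeCumulant m ((B.sort (· ≤ ·)).map w))
      (Ico 0 (l :: v).length) := by
    have := hw 0 (l :: v).length (by simp)
    rwa [hword 0 (l :: v) rfl, Nat.zero_add] at this
  have h1 : ncSum (fun B => freeCumulant m ((B.sort (· ≤ ·)).map w)) (Ico 0 (l :: v).length) =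
      blockSum (fun B => freeCumulant m ((B.sort (· ≤ ·)).map w)) {0} 1 1 (l :: v).length := by
    have hU : ({0} : Finset ℕ) ∪ Ico 1 (l :: v).length = Ico 0 (l :: v).length := by
      ext x
      simp only [mem_union, mem_singleton, mem_Ico, List.length_cons]
      omega
    rw [ncSum, blockSum, hU]
    congr 1
    rw [eq_comm, filter_eq_self]
    intro P hP
    rw [mem_ncSets] at hP
    obtain ⟨V, hV, h⟩ := hP.exists_mem 0 (by simp)
    exact ⟨V, hV, by simpa using h, by simp⟩
  have h2 := blockSum_eq_gapSum (freeCumulant m) m w hw v.length {0} 1 0 (by simp) (by simp)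
    (by simp [Nat.add_comm])
  rw [h0, h1]
  simp only [Nat.add_zero, List.range'_zero, List.map_nil, sort_singleton, List.map_cons,
    hword 1 v rfl] at h2
  exact h2

/-! ### Cumulants of a prescribed sequence -/

/-- The moments whose free cumulants are `κ`. -/
noncomputable def ncMoment {ι : Type*} (κ : List ι → ℂ) (w : List ι) : ℂ :=
  ∑ π ∈ ncPartitions w.length, ∏ B ∈ π.parts, κ (wordRestrict w B)

theorem ncMoment_nil {ι : Type*} (κ : List ι → ℂ) : ncMoment κ [] = 1 := by
  classical
  have h : ∀ π : Finpartition (univ : Finset (Fin 0)), π.parts = ∅ := fun π => by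
    refine eq_empty_of_forall_notMem fun B hB => ?_
    obtain ⟨x, -⟩ := π.nonempty_of_mem_parts hB
    exact x.elim0
  have h1 : ncPartitions 0 = univ := by
    refine filter_eq_self.2 fun π _ V hV => ?_
    rw [h π] at hV
    exact (notMem_empty V hV).elim
  let π₀ : Finpartition (univ : Finset (Fin 0)) :=
    Finpartition.ofExistsUnique ∅ (by simp) (fun x => x.elim0) (by simp)
  have h2 : (univ : Finset (Finpartition (univ : Finset (Fin 0)))) = {π₀} :=
    eq_singleton_iff_unique_mem.2 ⟨mem_univ _, fun π _ => Finpartition.ext ((h π).trans (h π₀).symm)⟩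
  simp only [ncMoment, List.length_nil]
  rw [h1, h2, sum_singleton]
  exact (prod_congr (h π₀) fun _ _ => rfl).trans prod_empty

theorem freeCumulant_ncMoment {ι : Type*} (κ : List ι → ℂ) (h0 : κ [] = 0) (w : List ι) :
    freeCumulant (ncMoment κ) w = κ w := by
  classical
  induction hn : w.length using Nat.strong_induction_on generalizing w with
  | _ n ih =>
  by_cases hw : w = []
  · rw [hw, freeCumulant_nil, h0]
  have hlt : ∀ B : Finset (Fin w.length), B ≠ univ →
      freeCumulant (ncMoment κ) (wordRestrict w B) = κ (wordRestrict w B) := by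
    intro B hB
    refine ih _ ?_ _ rfl
    rw [length_wordRestrict, ← hn]
    refine lt_of_le_of_ne (by simpa using card_le_univ B) fun h => hB ?_
    exact (card_eq_iff_eq_univ _).1 (by simpa using h)
  have hmc := moment_cumulant_formula (ncMoment κ) w hw
  rw [ncMoment, ← sub_eq_zero, ← sum_sub_distrib] at hmc
  have hne : (univ : Finset (Fin w.length)) ≠ ⊥ := by
    rw [bot_eq_empty]
    exact Nonempty.ne_empty ⟨⟨0, List.length_pos_iff.2 hw⟩, mem_univ _⟩
  have hnc : Finpartition.indiscrete hne ∈ ncPartitions w.length := by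
    simp only [ncPartitions, mem_filter, mem_univ, true_and]
    intro V hV W hW i j k l _ _ _ _ _ _ _
    simp only [Finpartition.indiscrete_parts, mem_singleton] at hV hW
    rw [hV, hW]
  rw [sum_eq_single_of_mem _ hnc, Finpartition.indiscrete_parts, prod_singleton, prod_singleton,
    wordRestrict_univ, sub_eq_zero] at hmc
  · exact hmc.symm
  · intro π _ hπ
    refine sub_eq_zero.2 (prod_congr rfl fun B hB => (hlt B ?_).symm)
    rintro rfl
    refine hπ (Finpartition.ext ?_)
    rw [Finpartition.indiscrete_parts]
    refine eq_singleton_iff_unique_mem.2 ⟨hB, fun C hC => ?_⟩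
    obtain ⟨x, hx⟩ := π.nonempty_of_mem_parts hC
    exact π.eq_of_mem_parts hC hB hx (mem_univ x)

/-! ### Nilpotent filtrations and sums over words -/

/-- A decreasing multiplicative filtration of a complex algebra that reaches `0` in finitely many
steps. Elements of `F 1` are nilpotent, so that power series, also in non-commuting indeterminates,
may be evaluated at them. -/
structure NilFiltration (R : Type*) [Ring R] [Algebra ℂ R] where
  /-- The steps of the filtration. -/
  F : ℕ → Submodule ℂ R
  /-- A step at which the filtration vanishes. -/
  K : ℕ
  anti : Antitone F
  one_mem : 1 ∈ F 0
  mul_mem : ∀ {a b : ℕ} {x y : R}, x ∈ F a → y ∈ F b → x * y ∈ F (a + b)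
  eq_zero : ∀ {x : R}, x ∈ F K → x = 0

/-- The value `∑ f(t) M_t` at a tuple `M` of a power series in non-commuting indeterminates, the sum
being over the words `t` of length `< k`, with `M_t` the product of the `M l`, `l ∈ t`. -/
noncomputable def wordSum {R : Type*} [Ring R] [Algebra ℂ R] {ι : Type*} [Fintype ι] (M : ι → R) :
    ℕ → (List ι → ℂ) → R
  | 0, _ => 0
  | k + 1, f => f [] • 1 + ∑ l, M l * wordSum M k (fun t => f (l :: t))

/-- The product of two power series in non-commuting indeterminates, in terms of coefficients. -/
def wordConv {ι : Type*} : (List ι → ℂ) → (List ι → ℂ) → List ι → ℂ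
  | f, g, [] => f [] * g []
  | f, g, l :: t => f [] * g (l :: t) + wordConv (fun s => f (l :: s)) g t

theorem gapSum_eq_wordConv {ι : Type*} (κ m : List ι → ℂ) : ∀ c p v : List ι,
    gapSum κ m c p v = wordConv (fun s => m (p ++ s))
      (fun t => t.casesOn (κ c) fun l v => gapSum κ m (c ++ [l]) [] v) v := by
  intro c p v
  induction v generalizing p with
  | nil => simp [gapSum, wordConv, mul_comm]
  | cons l v ih => simp [gapSum, wordConv, ih]

section WordSum

variable {R : Type*} [Ring R] [Algebra ℂ R] {ι : Type*} [Fintype ι]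

theorem wordSum_add (M : ι → R) (k : ℕ) : ∀ f g : List ι → ℂ,
    wordSum M k (fun t => f t + g t) = wordSum M k f + wordSum M k g := by
  induction k with
  | zero => intro f g; simp [wordSum]
  | succ k ih =>
    intro f g
    simp only [wordSum, ih, mul_add, sum_add_distrib, add_smul]
    abel

theorem wordSum_smul (M : ι → R) (k : ℕ) : ∀ (c : ℂ) (f : List ι → ℂ),
    wordSum M k (fun t => c * f t) = c • wordSum M k f := by
  induction k with
  | zero => intro c f; simp [wordSum]
  | succ k ih =>
    intro c f
    simp only [wordSum, ih, smul_add, smul_sum, mul_smul_comm, mul_smul]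

theorem wordSum_zero (M : ι → R) (k : ℕ) : wordSum M k (fun _ => 0) = 0 := by
  have := wordSum_smul M k 0 (fun _ => 0)
  simpa using this

theorem wordSum_conj (N : ι → R) {c c' : R} (h : c' * c = 1) (h' : c * c' = 1) (k : ℕ) :
    ∀ f : List ι → ℂ, wordSum (fun l => c' * N l * c) k f = c' * wordSum N k f * c := by
  induction k with
  | zero => intro f; simp [wordSum]
  | succ k ih =>
    intro f
    simp only [wordSum, ih, mul_add, add_mul, mul_sum, sum_mul]
    congr 1
    · rw [mul_smul_comm, mul_one, smul_mul_assoc, h]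
    · refine sum_congr rfl fun l _ => ?_
      calc c' * N l * c * (c' * wordSum N k (fun t => f (l :: t)) * c)
          = c' * N l * (c * c') * wordSum N k (fun t => f (l :: t)) * c := by noncomm_ring
        _ = _ := by rw [h']; noncomm_ring

end WordSum

namespace NilFiltration

variable {R : Type*} [Ring R] [Algebra ℂ R] (Φ : NilFiltration R) {ι : Type*} [Fintype ι]

variable {Φ} in
theorem mem_of_le {a b : ℕ} (h : a ≤ b) {x : R} (hx : x ∈ Φ.F b) : x ∈ Φ.F a := Φ.anti h hx

variable {Φ} in
theorem mul_mem_right {a : ℕ} {x y : R} (hx : x ∈ Φ.F 0) (hy : y ∈ Φ.F a) : x * y ∈ Φ.F a := by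
  simpa using Φ.mul_mem hx hy

variable {Φ} in
theorem mul_mem_left {a : ℕ} {x y : R} (hx : x ∈ Φ.F a) (hy : y ∈ Φ.F 0) : x * y ∈ Φ.F a := by
  simpa using Φ.mul_mem hx hy

variable {Φ} in
theorem mul_mem_succ {a : ℕ} {x y : R} (hx : x ∈ Φ.F 1) (hy : y ∈ Φ.F a) :
    x * y ∈ Φ.F (a + 1) := by
  rw [add_comm]; exact Φ.mul_mem hx hy

variable {Φ} in
theorem mul_mem_one {x y : R} (hx : x ∈ Φ.F 1) (hy : y ∈ Φ.F 1) : x * y ∈ Φ.F 1 :=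
  mul_mem_left hx (mem_of_le zero_le_one hy)

variable {Φ} in
theorem pow_mem {x : R} (hx : x ∈ Φ.F 1) (k : ℕ) : x ^ k ∈ Φ.F k := by
  induction k with
  | zero => simpa using Φ.one_mem
  | succ k ih => rw [pow_succ]; exact Φ.mul_mem ih hx

theorem eq_zero_of_le {k : ℕ} (hk : Φ.K ≤ k) {x : R} (hx : x ∈ Φ.F k) : x = 0 :=
  Φ.eq_zero (mem_of_le hk hx)

theorem pow_eq_zero {x : R} (hx : x ∈ Φ.F 1) {k : ℕ} (hk : Φ.K ≤ k) : x ^ k = 0 :=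
  Φ.eq_zero_of_le hk (pow_mem hx k)

theorem eq_of_forall {x y : R} (h : ∀ k, x - y ∈ Φ.F k → x - y ∈ Φ.F (k + 1))
    (h0 : x - y ∈ Φ.F 0) : x = y := by
  have h1 : ∀ k, x - y ∈ Φ.F k := fun k => Nat.rec h0 h k
  exact sub_eq_zero.1 (Φ.eq_zero (h1 _))

theorem one_sub_mul_geom {x : R} (hx : x ∈ Φ.F 1) : (1 - x) * ∑ k ∈ range Φ.K, x ^ k = 1 := by
  rw [mul_neg_geom_sum, Φ.pow_eq_zero hx le_rfl, sub_zero]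

theorem geom_mul_one_sub {x : R} (hx : x ∈ Φ.F 1) : (∑ k ∈ range Φ.K, x ^ k) * (1 - x) = 1 := by
  rw [geom_sum_mul_neg, Φ.pow_eq_zero hx le_rfl, sub_zero]

theorem geom_mem {x : R} (hx : x ∈ Φ.F 1) (K : ℕ) : ∑ k ∈ range K, x ^ k ∈ Φ.F 0 :=
  sum_mem fun k _ => mem_of_le (Nat.zero_le k) (pow_mem hx k)

/-- An element of `1 + F 1` has a two-sided inverse in `1 + F 1`. -/
theorem exists_inverse {w : R} (hw : w - 1 ∈ Φ.F 1) :
    ∃ v : R, w * v = 1 ∧ v * w = 1 ∧ v ∈ Φ.F 0 ∧ v - 1 ∈ Φ.F 1 := by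
  have hx : 1 - w ∈ Φ.F 1 := by rw [← neg_sub]; exact neg_mem hw
  have h1 := Φ.one_sub_mul_geom hx
  have h2 := Φ.geom_mul_one_sub hx
  have h3 := Φ.geom_mem hx Φ.K
  rw [sub_sub_cancel] at h1 h2
  refine ⟨_, h1, h2, h3, ?_⟩
  have h4 : (∑ k ∈ range Φ.K, (1 - w) ^ k) - 1 =
      (1 - w) * ∑ k ∈ range Φ.K, (1 - w) ^ k := by
    rw [sub_mul, one_mul, h1]
  rw [h4]
  exact mul_mem_left hx h3

theorem wordSum_mem {M : ι → R} (hM : ∀ l, M l ∈ Φ.F 1) (k : ℕ) :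
    ∀ f : List ι → ℂ, wordSum M k f ∈ Φ.F 0 := by
  induction k with
  | zero => intro f; exact zero_mem _
  | succ k ih =>
    intro f
    exact add_mem (Submodule.smul_mem _ _ Φ.one_mem)
      (sum_mem fun l _ => mem_of_le zero_le_one (mul_mem_left (hM l) (ih _)))

theorem wordSum_mem_one {M : ι → R} (hM : ∀ l, M l ∈ Φ.F 1) (k : ℕ) (f : List ι → ℂ)
    (hf : f [] = 0) : wordSum M k f ∈ Φ.F 1 := by
  cases k with
  | zero => exact zero_mem _
  | succ k =>
    rw [wordSum, hf, zero_smul, zero_add]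
    exact sum_mem fun l _ => mul_mem_left (hM l) (Φ.wordSum_mem hM k _)

theorem wordSum_succ_sub_mem {M : ι → R} (hM : ∀ l, M l ∈ Φ.F 1) (k : ℕ) :
    ∀ f : List ι → ℂ, wordSum M (k + 1) f - wordSum M k f ∈ Φ.F k := by
  induction k with
  | zero =>
    intro f
    exact sub_mem (Φ.wordSum_mem hM 1 f) (Φ.wordSum_mem hM 0 f)
  | succ k ih =>
    intro f
    rw [wordSum, wordSum.eq_2 M f k, add_sub_add_left_eq_sub, ← sum_sub_distrib]
    refine sum_mem fun l _ => ?_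
    rw [← mul_sub]
    exact mul_mem_succ (hM l) (ih _)

/-- Words of length at least `K` do not contribute. -/
theorem wordSum_cons {M : ι → R} (hM : ∀ l, M l ∈ Φ.F 1) (f : List ι → ℂ) :
    wordSum M Φ.K f = f [] • 1 + ∑ l, M l * wordSum M Φ.K (fun t => f (l :: t)) := by
  have h := Φ.eq_zero (Φ.wordSum_succ_sub_mem hM Φ.K f)
  rw [sub_eq_zero] at h
  rw [← h, wordSum]

theorem wordSum_sub_mem_of_le {M : ι → R} (hM : ∀ l, M l ∈ Φ.F 1) {j k : ℕ} (hjk : j ≤ k)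
    (f : List ι → ℂ) : wordSum M k f - wordSum M j f ∈ Φ.F j := by
  induction k, hjk using Nat.le_induction with
  | base => simp
  | succ k hk ih =>
    rw [← sub_add_sub_cancel _ (wordSum M k f)]
    exact add_mem (mem_of_le hk (Φ.wordSum_succ_sub_mem hM k f)) ih

theorem wordSum_contraction {M M' : ι → R} (hM : ∀ l, M l ∈ Φ.F 1) (hM' : ∀ l, M' l ∈ Φ.F 1)
    {d : ℕ} (h : ∀ l, M l - M' l ∈ Φ.F d) (k : ℕ) :
    ∀ f : List ι → ℂ, wordSum M k f - wordSum M' k f ∈ Φ.F d := by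
  induction k with
  | zero => intro f; simp [wordSum]
  | succ k ih =>
    intro f
    rw [wordSum, wordSum, add_sub_add_left_eq_sub, ← sum_sub_distrib]
    refine sum_mem fun l _ => ?_
    have h1 : M l * wordSum M k (fun t => f (l :: t)) - M' l * wordSum M' k (fun t => f (l :: t)) =
        (M l - M' l) * wordSum M k (fun t => f (l :: t)) +
          M' l * (wordSum M k (fun t => f (l :: t)) - wordSum M' k (fun t => f (l :: t))) := by
      noncomm_ring
    rw [h1]
    exact add_mem (mul_mem_left (h l) (Φ.wordSum_mem hM k _))
      (mul_mem_right (mem_of_le zero_le_one (hM' l)) (ih _))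

theorem wordSum_mul_right_contraction {Λ : ι → R} (hΛ : ∀ l, Λ l ∈ Φ.F 1) {g w : R}
    (hg : g ∈ Φ.F 0) (hw : w ∈ Φ.F 0) {d : ℕ} (h : g - w ∈ Φ.F d) (k : ℕ) (f : List ι → ℂ) :
    wordSum (fun l => Λ l * g) k f - wordSum (fun l => Λ l * w) k f ∈ Φ.F (d + 1) := by
  refine Φ.wordSum_contraction (fun l => mul_mem_left (hΛ l) hg)
    (fun l => mul_mem_left (hΛ l) hw) (fun l => ?_) k f
  rw [← mul_sub]
  exact mul_mem_succ (hΛ l) h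

theorem wordSum_conv {M : ι → R} (hM : ∀ l, M l ∈ Φ.F 1) (f g : List ι → ℂ) :
    wordSum M Φ.K (wordConv f g) = wordSum M Φ.K f * wordSum M Φ.K g := by
  have key : ∀ (k : ℕ) (f : List ι → ℂ),
      wordSum M k (wordConv f g) - wordSum M k f * wordSum M Φ.K g ∈ Φ.F k := by
    intro k
    induction k with
    | zero =>
      intro f
      exact sub_mem (Φ.wordSum_mem hM 0 _)
        (mul_mem_right (Φ.wordSum_mem hM 0 _) (Φ.wordSum_mem hM _ _))
    | succ k ih =>
      intro f
      have h1 : wordSum M (k + 1) (wordConv f g) = f [] • wordSum M (k + 1) g +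
          ∑ l, M l * wordSum M k (wordConv (fun s => f (l :: s)) g) := by
        simp only [wordSum, wordConv, wordSum_add, wordSum_smul, mul_add, sum_add_distrib, smul_add,
          smul_sum, mul_smul_comm, mul_smul]
        abel
      have h2 : wordSum M (k + 1) (wordConv f g) - wordSum M (k + 1) f * wordSum M Φ.K g =
          f [] • (wordSum M (k + 1) g - wordSum M Φ.K g) +
          ∑ l, M l * (wordSum M k (wordConv (fun s => f (l :: s)) g) -
            wordSum M k (fun s => f (l :: s)) * wordSum M Φ.K g) := by
        rw [h1, wordSum.eq_2 M f k]
        simp only [mul_sub, sum_sub_distrib, add_mul, sum_mul, smul_sub, smul_mul_assoc, one_mul,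
          mul_assoc]
        abel
      rw [h2]
      refine add_mem (Submodule.smul_mem _ _ ?_) (sum_mem fun l _ => mul_mem_succ (hM l) (ih _))
      rcases le_total (k + 1) Φ.K with h | h
      · rw [← neg_sub]
        exact neg_mem (Φ.wordSum_sub_mem_of_le hM h g)
      · rw [Φ.eq_zero (Φ.wordSum_sub_mem_of_le hM h g)]
        exact zero_mem _
  exact sub_eq_zero.1 (Φ.eq_zero (key Φ.K f))

/-! ### The functional equation of the `R`-transform -/

/-- The functional equation `M = R(z (1 + M))` between the moment series and the `R`-transform of a
tuple, evaluated at nilpotent coefficients `Λ`. -/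
theorem wordSum_moment {Λ : ι → R} (hΛ : ∀ l, Λ l ∈ Φ.F 1) {m : List ι → ℂ} (hm : m [] = 1) :
    wordSum Λ Φ.K m =
      1 + wordSum (fun l => Λ l * wordSum Λ Φ.K m) Φ.K (freeCumulant m) := by
  set W := wordSum Λ Φ.K m with hW
  have hW0 : W ∈ Φ.F 0 := Φ.wordSum_mem hΛ _ _
  have hΛW : ∀ l, Λ l * W ∈ Φ.F 1 := fun l => mul_mem_left (hΛ l) hW0
  set κ := freeCumulant m with hκ
  have hG : ∀ c, wordSum Λ Φ.K (gapSum κ m c []) =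
      W * (κ c • 1 + ∑ l, Λ l * wordSum Λ Φ.K (gapSum κ m (c ++ [l]) [])) := by
    intro c
    have h1 : gapSum κ m c [] = wordConv m
        (fun t => t.casesOn (κ c) fun l v => gapSum κ m (c ++ [l]) [] v) :=
      funext fun v => gapSum_eq_wordConv κ m c [] v
    rw [h1, Φ.wordSum_conv hΛ, ← hW, Φ.wordSum_cons hΛ]
  have key : ∀ (k : ℕ) (c : List ι), wordSum Λ Φ.K (gapSum κ m c []) -
      W * wordSum (fun l => Λ l * W) k (fun t => κ (c ++ t)) ∈ Φ.F k := by
    intro k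
    induction k with
    | zero =>
      intro c
      exact sub_mem (Φ.wordSum_mem hΛ _ _) (mul_mem_right hW0 (Φ.wordSum_mem hΛW _ _))
    | succ k ih =>
      intro c
      have h2 : wordSum Λ Φ.K (gapSum κ m c []) -
          W * wordSum (fun l => Λ l * W) (k + 1) (fun t => κ (c ++ t)) =
          W * ∑ l, Λ l * (wordSum Λ Φ.K (gapSum κ m (c ++ [l]) []) -
            W * wordSum (fun l => Λ l * W) k (fun t => κ ((c ++ [l]) ++ t))) := by
        rw [hG c, wordSum, ← mul_sub, List.append_nil, add_sub_add_left_eq_sub, ← sum_sub_distrib]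
        simp only [mul_sub, mul_assoc, List.append_assoc, List.singleton_append]
      rw [h2]
      exact mul_mem_right hW0 (sum_mem fun l _ => mul_mem_succ (hΛ l) (ih _))
  have hκ0 : κ [] = 0 := freeCumulant_nil m
  have hWm : W = 1 + ∑ l, Λ l * wordSum Λ Φ.K (fun t => m (l :: t)) := by
    rw [hW, Φ.wordSum_cons hΛ m, hm, one_smul]
  rw [Φ.wordSum_cons hΛW κ, hκ0, zero_smul, zero_add]
  refine hWm.trans ?_
  congr 1
  refine sum_congr rfl fun l _ => ?_
  rw [mul_assoc]
  congr 1
  have h3 : (fun t => m (l :: t)) = gapSum κ m [l] [] :=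
    funext fun v => moment_cons_eq_gapSum m hm l v
  rw [h3]
  exact sub_eq_zero.1 (Φ.eq_zero (key Φ.K [l]))

end NilFiltration

/-! ### Matrices over a noncommutative probability space -/

section Matrices

variable {n : Type*} [Fintype n] [DecidableEq n] {B : Type*} [Ring B] [Algebra ℂ B]

/-- The filtration of a matrix algebra given by a grading `g` of the index set: `F d` consists of the
matrices all of whose nonzero entries raise the degree by at least `d`. -/
def gradeFiltration (g : n → ℕ) (B : Type*) [Ring B] [Algebra ℂ B] :
    NilFiltration (Matrix n n B) where
  F d :=
    { carrier := {M | ∀ i j, g j < g i + d → M i j = 0}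
      add_mem' := fun {M N} hM hN i j h => by
        rw [Matrix.add_apply, hM i j h, hN i j h, add_zero]
      zero_mem' := fun i j _ => rfl
      smul_mem' := fun c M hM i j h => by rw [Matrix.smul_apply, hM i j h, smul_zero] }
  K := univ.sup g + 1
  anti := fun a b hab M hM i j h => hM i j (by omega)
  one_mem := fun i j h => Matrix.one_apply_ne (by rintro rfl; omega)
  mul_mem := fun {a b M N} hM hN i j h => by
    rw [Matrix.mul_apply]
    refine sum_eq_zero fun k _ => ?_
    by_cases hk : g k < g i + a
    · rw [hM i k hk, zero_mul]
    · rw [hN k j (by omega), mul_zero]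
  eq_zero := fun {M} hM => by
    ext i j
    refine hM i j ?_
    have : g j ≤ univ.sup g := le_sup (mem_univ j)
    omega

/-- The elementary tensor `x ⊗ Λ` of `x ∈ B` and a scalar matrix `Λ`, as a matrix over `B`. -/
def tens (x : B) (Λ : Matrix n n ℂ) : Matrix n n B := Λ.map fun c => c • x

omit [Fintype n] [DecidableEq n] in
theorem tens_apply (x : B) (Λ : Matrix n n ℂ) (i j : n) : tens x Λ i j = Λ i j • x := rfl

omit [DecidableEq n] in
theorem tens_mul_tens (x y : B) (Λ Γ : Matrix n n ℂ) :
    tens x Λ * tens y Γ = tens (x * y) (Λ * Γ) := by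
  ext i j
  simp only [Matrix.mul_apply, tens_apply, sum_smul]
  refine sum_congr rfl fun k _ => ?_
  rw [smul_mul_smul_comm]

omit [Fintype n] in
theorem tens_one_one : tens (1 : B) (1 : Matrix n n ℂ) = 1 := by
  ext i j
  rw [tens_apply, Matrix.one_apply, Matrix.one_apply]
  split_ifs <;> simp

omit [Fintype n] [DecidableEq n] in
theorem tens_sub (x : B) (Λ Γ : Matrix n n ℂ) : tens x (Λ - Γ) = tens x Λ - tens x Γ := by
  ext i j; simp [tens_apply, sub_smul]

omit [Fintype n] [DecidableEq n] in
theorem tens_zero (x : B) : tens x (0 : Matrix n n ℂ) = 0 := by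
  ext i j; simp [tens_apply]

theorem tens_mem {g : n → ℕ} {d : ℕ} {Λ : Matrix n n ℂ} (h : Λ ∈ (gradeFiltration g ℂ).F d)
    (x : B) : tens x Λ ∈ (gradeFiltration g B).F d := fun i j hij => by
  rw [tens_apply, h i j hij, zero_smul]

/-- The entrywise expectation of a matrix over a noncommutative probability space. -/
def expect (φ : UnitalFunctional B) : Matrix n n B →ₗ[ℂ] Matrix n n ℂ := φ.toLin.mapMatrix

omit [Fintype n] [DecidableEq n] in
theorem expect_apply (φ : UnitalFunctional B) (M : Matrix n n B) (i j : n) :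
    expect φ M i j = φ.toLin (M i j) := rfl

omit [DecidableEq n] in
theorem expect_tens_one_mul (φ : UnitalFunctional B) (Λ : Matrix n n ℂ) (M : Matrix n n B) :
    expect φ (tens 1 Λ * M) = Λ * expect φ M := by
  ext i j
  simp [expect_apply, Matrix.mul_apply, tens_apply]

omit [DecidableEq n] in
theorem expect_mul_tens_one (φ : UnitalFunctional B) (Λ : Matrix n n ℂ) (M : Matrix n n B) :
    expect φ (M * tens 1 Λ) = expect φ M * Λ := by
  ext i j
  simp [expect_apply, Matrix.mul_apply, tens_apply, mul_comm]

omit [Fintype n] [DecidableEq n] in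
theorem expect_tens (φ : UnitalFunctional B) (x : B) (Λ : Matrix n n ℂ) :
    expect φ (tens x Λ) = φ.toLin x • Λ := by
  ext i j
  simp [expect_apply, tens_apply, mul_comm]

omit [Fintype n] in
theorem expect_one (φ : UnitalFunctional B) : expect φ (1 : Matrix n n B) = 1 := by
  rw [← tens_one_one, expect_tens, φ.map_one, one_smul]

variable {ι : Type*} [Fintype ι]

/-- The expectation of a resolvent of a tuple is its moment series. -/
theorem expect_geom_sum (φ : UnitalFunctional B) (x : ι → B) (Λ : ι → Matrix n n ℂ) (K : ℕ) :
    ∀ b : B, expect φ (tens b 1 * ∑ k ∈ range K, (∑ l, tens (x l) (Λ l)) ^ k) =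
      wordSum Λ K (fun t => φ.toLin (b * (t.map x).prod)) := by
  induction K with
  | zero => intro b; simp [wordSum]
  | succ K ih =>
    intro b
    rw [sum_range_succ', pow_zero, mul_add, map_add, mul_one, expect_tens, wordSum, add_comm]
    simp only [List.map_nil, List.prod_nil, mul_one]
    congr 1
    simp only [pow_succ']
    rw [← mul_sum, sum_mul, mul_sum, map_sum]
    refine sum_congr rfl fun l _ => ?_
    have h1 : tens b 1 * (tens (x l) (Λ l) * ∑ k ∈ range K, (∑ l, tens (x l) (Λ l)) ^ k) =
        tens 1 (Λ l) * (tens (b * x l) 1 * ∑ k ∈ range K, (∑ l, tens (x l) (Λ l)) ^ k) := by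
      rw [← mul_assoc, ← mul_assoc, tens_mul_tens, tens_mul_tens, one_mul, mul_one, one_mul]
    rw [h1, expect_tens_one_mul, ih]
    simp only [List.map_cons, List.prod_cons, mul_assoc]

/-! ### Alternating products of centred matrices -/

omit [DecidableEq n] in
theorem mul_apply_mem {S : Subalgebra ℂ B} {M N : Matrix n n B} (hM : ∀ i j, M i j ∈ S)
    (hN : ∀ i j, N i j ∈ S) (i j : n) : (M * N) i j ∈ S := by
  rw [Matrix.mul_apply]
  exact sum_mem fun k _ => mul_mem (hM i k) (hN k j)

omit [Fintype n] in
theorem one_apply_mem (S : Subalgebra ℂ B) (i j : n) : (1 : Matrix n n B) i j ∈ S := by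
  rw [Matrix.one_apply]
  split_ifs
  · exact one_mem S
  · exact zero_mem S

omit [Fintype n] [DecidableEq n] in
theorem tens_apply_mem {S : Subalgebra ℂ B} {x : B} (hx : x ∈ S) (Λ : Matrix n n ℂ) (i j : n) :
    tens x Λ i j ∈ S := S.smul_mem hx _

theorem pow_apply_mem {S : Subalgebra ℂ B} {M : Matrix n n B} (hM : ∀ i j, M i j ∈ S) (k : ℕ) :
    ∀ i j, (M ^ k) i j ∈ S := by
  induction k with
  | zero => rw [pow_zero]; exact one_apply_mem S
  | succ k ih => rw [pow_succ]; exact mul_apply_mem ih hM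

/-- The alternating product of length `k` of `e true` and `e false` with first factor `e b`. -/
def altProd {R : Type*} [Monoid R] (e : Bool → R) : Bool → ℕ → R
  | _, 0 => 1
  | b, k + 1 => e b * altProd e (!b) k

/-- Freeness for matrices: alternating products of centred matrices over free subalgebras are
centred. -/
theorem expect_altProd (φ : UnitalFunctional B) {S T : Set B} (hfree : φ.AreFree S T)
    (e : Bool → Matrix n n B)
    (he : ∀ b i j, e b i j ∈ Algebra.adjoin ℂ (if b then S else T))
    (he0 : ∀ b, expect φ (e b) = 0) (b : Bool) (k : ℕ) :
    expect φ (altProd e b (k + 1)) = 0 := by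
  have key : ∀ (k : ℕ) (b : Bool) (p : List (Bool × B)),
      p ≠ [] ∨ k ≠ 0 →
      (p.map Prod.fst).IsChain (· ≠ ·) → (∀ c ∈ (p.map Prod.fst).getLast?, c ≠ b) →
      (∀ q ∈ p, q.2 ∈ Algebra.adjoin ℂ (if q.1 then S else T) ∧ φ.toLin q.2 = 0) →
      ∀ i j, φ.toLin ((p.map Prod.snd).prod * altProd e b k i j) = 0 := by
    intro k
    induction k with
    | zero =>
      intro b p hp hchain _ hc i j
      have h1 := hfree p (by simpa using hp) hchain hc
      rw [altProd, Matrix.one_apply]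
      split_ifs <;> simp [h1]
    | succ k ih =>
      intro b p _ hchain hlast hc i j
      rw [altProd, Matrix.mul_apply, mul_sum, map_sum]
      refine sum_eq_zero fun r _ => ?_
      have h2 := ih (!b) (p ++ [(b, e b i r)]) (by simp) ?_ (by simp) ?_ r j
      · simpa [mul_assoc] using h2
      · rw [List.map_append, List.isChain_append]
        refine ⟨hchain, by simp, fun c hc d hd => ?_⟩
        obtain rfl : b = d := by simpa using hd
        exact hlast c hc
      · intro q hq
        rcases List.mem_append.1 hq with h | h
        · exact hc q h
        · rw [List.mem_singleton.1 h]
          refine ⟨he b i r, ?_⟩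
          have := congr_fun (congr_fun (he0 b) i) r
          exact this
  ext i j
  have := key (k + 1) b [] (by simp) (by simp) (by simp) (by simp) i j
  simpa [expect_apply] using this

/-- The sum of all alternating products that start with `e b` is `e b` times one plus the sum of those
that start with the other factor. -/
theorem sum_altProd {R : Type*} [Ring R] [Algebra ℂ R] (Φ : NilFiltration R) (e : Bool → R)
    (he : ∀ b, e b ∈ Φ.F 1) (b : Bool) :
    ∑ k ∈ range Φ.K, altProd e b (k + 1) =
      e b * (1 + ∑ k ∈ range Φ.K, altProd e (!b) (k + 1)) := by
  have hmem : ∀ (k : ℕ) (b : Bool), altProd e b k ∈ Φ.F k := by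
    intro k
    induction k with
    | zero => intro b; exact Φ.one_mem
    | succ k ih => intro b; exact NilFiltration.mul_mem_succ (he b) (ih _)
  have h1 := sum_range_succ' (fun k => altProd e (!b) k) Φ.K
  rw [sum_range_succ, Φ.eq_zero (hmem Φ.K (!b)), add_zero] at h1
  calc ∑ k ∈ range Φ.K, altProd e b (k + 1)
      = e b * ∑ k ∈ range Φ.K, altProd e (!b) k := by simp only [altProd, mul_sum]
    _ = _ := by rw [h1, add_comm]; rfl

/-! ### Additivity of the `R`-transform -/

/-- The fixed point equation `w = 1 + R(Λ w) + R'(Λ' w)` has a solution: iterate. Each step of the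
iteration gains one step of the filtration. -/
theorem exists_fixedPoint {R : Type*} [Ring R] [Algebra ℂ R] (Φ : NilFiltration R)
    {ι ι' : Type*} [Fintype ι] [Fintype ι'] {Λ : ι → R} {Λ' : ι' → R}
    (hΛ : ∀ l, Λ l ∈ Φ.F 1) (hΛ' : ∀ l, Λ' l ∈ Φ.F 1) (κ : List ι → ℂ) (κ' : List ι' → ℂ) :
    ∃ w ∈ Φ.F 0, w = 1 + wordSum (fun l => Λ l * w) Φ.K κ +
      wordSum (fun l => Λ' l * w) Φ.K κ' := by
  let s : ℕ → R := fun k => Nat.rec 1 (fun _ w => 1 + wordSum (fun l => Λ l * w) Φ.K κ +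
      wordSum (fun l => Λ' l * w) Φ.K κ') k
  have hs : ∀ k, s (k + 1) = 1 + wordSum (fun l => Λ l * s k) Φ.K κ +
      wordSum (fun l => Λ' l * s k) Φ.K κ' := fun k => rfl
  have h0 : ∀ k, s k ∈ Φ.F 0 := by
    intro k
    induction k with
    | zero => exact Φ.one_mem
    | succ k ih =>
      rw [hs]
      exact add_mem (add_mem Φ.one_mem
        (Φ.wordSum_mem (fun l => NilFiltration.mul_mem_left (hΛ l) ih) _ _))
        (Φ.wordSum_mem (fun l => NilFiltration.mul_mem_left (hΛ' l) ih) _ _)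
  have h1 : ∀ k, s (k + 1) - s k ∈ Φ.F k := by
    intro k
    induction k with
    | zero => exact sub_mem (h0 1) (h0 0)
    | succ k ih =>
      have h2 := add_mem (Φ.wordSum_mul_right_contraction hΛ (h0 (k + 1)) (h0 k) ih Φ.K κ)
        (Φ.wordSum_mul_right_contraction hΛ' (h0 (k + 1)) (h0 k) ih Φ.K κ')
      have h3 : s (k + 1 + 1) - s (k + 1) =
          wordSum (fun l => Λ l * s (k + 1)) Φ.K κ - wordSum (fun l => Λ l * s k) Φ.K κ +
          (wordSum (fun l => Λ' l * s (k + 1)) Φ.K κ' -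
            wordSum (fun l => Λ' l * s k) Φ.K κ') := by
        rw [hs (k + 1), hs k]
        abel
      rw [h3]
      exact h2
  refine ⟨s Φ.K, h0 _, ?_⟩
  rw [← hs, ← sub_eq_zero, ← neg_sub, Φ.eq_zero (h1 Φ.K), neg_zero]

/-- If `(1 - r) w = 1 + R(Λ w)`, with `R` the `R`-transform of the tuple `x`, then `w` is the expectation of `(1 - r - X)⁻¹`, where `X` is the
linear pencil `∑ x_l ⊗ Λ_l`. -/
theorem exists_resolvent (φ : UnitalFunctional B) (g : n → ℕ) (x : ι → B) {Λ : ι → Matrix n n ℂ}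
    (hΛ : ∀ l, Λ l ∈ (gradeFiltration g ℂ).F 1) {r w : Matrix n n ℂ}
    (hr : r ∈ (gradeFiltration g ℂ).F 1) (hw : w ∈ (gradeFiltration g ℂ).F 0)
    (h : (1 - r) * w = 1 + wordSum (fun l => Λ l * w) (gradeFiltration g ℂ).K
      (freeCumulant fun t => φ.toLin (t.map x).prod)) :
    ∃ G : Matrix n n B, (1 - tens 1 r - ∑ l, tens (x l) (Λ l)) * G = 1 ∧ expect φ G = w ∧
      G - 1 ∈ (gradeFiltration g B).F 1 ∧
      ∀ S : Subalgebra ℂ B, (∀ l, x l ∈ S) → ∀ i j, G i j ∈ S := by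
  set Φ := gradeFiltration g ℂ with hΦ
  set Ψ := gradeFiltration g B with hΨ
  have hK : Ψ.K = Φ.K := rfl
  set m : List ι → ℂ := fun t => φ.toLin (t.map x).prod with hm
  have hm1 : m [] = 1 := by simp [hm, φ.map_one]
  have hr' : (1 - r) - 1 ∈ Φ.F 1 := by
    rw [sub_sub_cancel_left]; exact neg_mem hr
  obtain ⟨c, hc1, hc2, hc0, -⟩ := Φ.exists_inverse hr'
  have hcΛ : ∀ l, c * Λ l ∈ Φ.F 1 := fun l => NilFiltration.mul_mem_right hc0 (hΛ l)
  set X : Matrix n n B := ∑ l, tens (x l) (c * Λ l) with hX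
  have hXm : X ∈ Ψ.F 1 := sum_mem fun l _ => tens_mem (hcΛ l) _
  set Q : Matrix n n B := ∑ k ∈ range Φ.K, X ^ k with hQ
  have hcX : tens 1 (1 - r) * X = ∑ l, tens (x l) (Λ l) := by
    rw [hX, mul_sum]
    refine sum_congr rfl fun l _ => ?_
    rw [tens_mul_tens, one_mul, ← mul_assoc, hc1, one_mul]
  have hfac : 1 - tens 1 r - ∑ l, tens (x l) (Λ l) = tens 1 (1 - r) * (1 - X) := by
    rw [mul_sub, hcX, mul_one, tens_sub, tens_one_one]
  have hQ1 : (1 - X) * Q = 1 := Ψ.one_sub_mul_geom hXm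
  have hQ0 : Q ∈ Ψ.F 0 := Ψ.geom_mem hXm _
  have hG1 : (1 - tens 1 r - ∑ l, tens (x l) (Λ l)) * (Q * tens 1 c) = 1 := by
    rw [hfac, mul_assoc, ← mul_assoc (1 - X), hQ1, one_mul, tens_mul_tens, hc1, one_mul,
      tens_one_one]
  have hEQ : expect φ Q = wordSum (fun l => c * Λ l) Φ.K m := by
    have h1 := expect_geom_sum φ x (fun l => c * Λ l) Φ.K 1
    rw [tens_one_one, one_mul] at h1
    simpa only [one_mul] using h1
  set V := wordSum (fun l => c * Λ l) Φ.K m with hV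
  have hVeq : V = 1 + wordSum (fun l => c * Λ l * V) Φ.K (freeCumulant m) := Φ.wordSum_moment hcΛ hm1
  have hV0 : V ∈ Φ.F 0 := Φ.wordSum_mem hcΛ _ _
  have hg0 : V * c ∈ Φ.F 0 := NilFiltration.mul_mem_left hV0 hc0
  have hg : (1 - r) * (V * c) =
      1 + wordSum (fun l => Λ l * (V * c)) Φ.K (freeCumulant m) := by
    have h1 : (fun l => c * Λ l * V) = fun l => c * (Λ l * (V * c)) * (1 - r) := by
      funext l
      calc c * Λ l * V = c * Λ l * (V * (c * (1 - r))) := by rw [hc2, mul_one]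
        _ = _ := by noncomm_ring
    rw [h1, wordSum_conj _ hc2 hc1] at hVeq
    calc (1 - r) * (V * c)
        = (1 - r) * ((1 + c * wordSum (fun l => Λ l * (V * c)) Φ.K (freeCumulant m) *
            (1 - r)) * c) := by rw [← hVeq]
      _ = (1 - r) * c + ((1 - r) * c) * wordSum (fun l => Λ l * (V * c)) Φ.K (freeCumulant m) *
            ((1 - r) * c) := by noncomm_ring
      _ = _ := by rw [hc1, one_mul, mul_one]
  have hgw : V * c = w := by
    refine Φ.eq_of_forall (fun k hk => ?_) (sub_mem hg0 hw)
    have h1 : V * c - w = r * (V * c - w) +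
        (wordSum (fun l => Λ l * (V * c)) Φ.K (freeCumulant m) -
          wordSum (fun l => Λ l * w) Φ.K (freeCumulant m)) := by
      have h2 : V * c - w = r * (V * c - w) + ((1 - r) * (V * c) - (1 - r) * w) := by noncomm_ring
      rw [hg, h, add_sub_add_left_eq_sub] at h2
      exact h2
    rw [h1]
    exact add_mem (NilFiltration.mul_mem_succ hr hk)
      (Φ.wordSum_mul_right_contraction hΛ hg0 hw hk _ _)
  have hc0' : tens (1 : B) c ∈ Ψ.F 0 := tens_mem hc0 1
  refine ⟨Q * tens 1 c, hG1, ?_, ?_, ?_⟩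
  · rw [expect_mul_tens_one, hEQ, hgw]
  · have h1 : Q * tens 1 c - 1 =
        (tens 1 r + ∑ l, tens (x l) (Λ l)) * (Q * tens 1 c) := by
      rw [← hG1]
      noncomm_ring
    rw [h1]
    exact NilFiltration.mul_mem_left
      (add_mem (tens_mem hr 1) (sum_mem fun l _ => tens_mem (hΛ l) _))
      (NilFiltration.mul_mem_left hQ0 hc0')
  · intro S hS
    have hXS : ∀ i j, X i j ∈ S := fun i j => by
      rw [hX, Matrix.sum_apply]
      exact sum_mem fun l _ => tens_apply_mem (hS l) _ i j
    refine mul_apply_mem (fun i j => ?_) (tens_apply_mem (one_mem S) c)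
    rw [hQ, Matrix.sum_apply]
    exact sum_mem fun k _ => pow_apply_mem hXS k i j

/-- **Additivity of the `R`-transform** for free tuples: the expectation `W` of the resolvent of
the linear pencil `∑ x_l ⊗ Λ_l + ∑ y_l ⊗ Λ'_l` satisfies `W = 1 + R(Λ W) + R'(Λ' W)`.
With `v = w⁻¹` for the solution `w` of this equation, the resolvents of the two pencils, each shifted by
the scalar part of the other, have expectation `w`; the sum of all alternating products of their
centred parts gives the resolvent of the sum of the pencils, and freeness shows that it has
expectation `w`. -/
theorem expect_resolvent_of_areFree (φ : UnitalFunctional B) {S T : Set B}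
    (hfree : φ.AreFree S T) (g : n → ℕ) {ι' : Type*} [Fintype ι'] {x : ι → B} {y : ι' → B}
    (hx : ∀ l, x l ∈ S) (hy : ∀ l, y l ∈ T) {Λ : ι → Matrix n n ℂ} {Λ' : ι' → Matrix n n ℂ}
    (hΛ : ∀ l, Λ l ∈ (gradeFiltration g ℂ).F 1) (hΛ' : ∀ l, Λ' l ∈ (gradeFiltration g ℂ).F 1)
    {G : Matrix n n B}
    (hG : G * (1 - (∑ l, tens (x l) (Λ l) + ∑ l, tens (y l) (Λ' l))) = 1) :
    expect φ G ∈ (gradeFiltration g ℂ).F 0 ∧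
    expect φ G = 1 +
      wordSum (fun l => Λ l * expect φ G) (gradeFiltration g ℂ).K
        (freeCumulant fun t => φ.toLin (t.map x).prod) +
      wordSum (fun l => Λ' l * expect φ G) (gradeFiltration g ℂ).K
        (freeCumulant fun t => φ.toLin (t.map y).prod) := by
  set Φ := gradeFiltration g ℂ with hΦ
  set Ψ := gradeFiltration g B with hΨ
  set κ := freeCumulant fun t => φ.toLin (t.map x).prod with hκ
  set κ' := freeCumulant fun t => φ.toLin (t.map y).prod with hκ'
  obtain ⟨w, hw0, hw⟩ := exists_fixedPoint Φ hΛ hΛ' κ κ'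
  suffices hEG : expect φ G = w by rw [hEG]; exact ⟨hw0, hw⟩
  set a := wordSum (fun l => Λ l * w) Φ.K κ with ha
  set a' := wordSum (fun l => Λ' l * w) Φ.K κ' with ha'
  have ha1 : a ∈ Φ.F 1 := Φ.wordSum_mem_one (fun l => NilFiltration.mul_mem_left (hΛ l) hw0) _ _
    (freeCumulant_nil _)
  have ha1' : a' ∈ Φ.F 1 := Φ.wordSum_mem_one (fun l => NilFiltration.mul_mem_left (hΛ' l) hw0) _ _
    (freeCumulant_nil _)
  have hw1 : w - 1 ∈ Φ.F 1 := by
    rw [hw, add_assoc, add_sub_cancel_left]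
    exact add_mem ha1 ha1'
  obtain ⟨v, hwv, hvw, hv0, hv1⟩ := Φ.exists_inverse hw1
  -- `a = R(Λ w)` and `a' = R'(Λ' w)`, so that `v = w⁻¹` is `1 - a v - a' v`
  have hv : v = 1 - a * v - a' * v := by
    have h1 : (1 - a * v - a' * v) * w = 1 := by
      calc (1 - a * v - a' * v) * w = w - a * (v * w) - a' * (v * w) := by noncomm_ring
        _ = w - a - a' := by rw [hvw, mul_one, mul_one]
        _ = 1 := by nth_rewrite 1 [hw]; abel
    calc v = (1 - a * v - a' * v) * w * v := by rw [h1, one_mul]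
      _ = _ := by rw [mul_assoc, hwv, mul_one]
  obtain ⟨G₁, hG₁, hEG₁, hG₁1, hG₁S⟩ := exists_resolvent φ g x hΛ
    (r := a' * v) (NilFiltration.mul_mem_left ha1' hv0) hw0 (by
      rw [sub_mul, one_mul, mul_assoc, hvw, mul_one, sub_eq_iff_eq_add]; exact hw)
  obtain ⟨G₂, hG₂, hEG₂, hG₂1, hG₂S⟩ := exists_resolvent φ g y hΛ'
    (r := a * v) (NilFiltration.mul_mem_left ha1 hv0) hw0 (by
      rw [sub_mul, one_mul, mul_assoc, hvw, mul_one, sub_eq_iff_eq_add, add_right_comm]; exact hw)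
  -- the centred parts of the two resolvents
  let e : Bool → Matrix n n B := fun b => if b then tens 1 v * G₁ - 1 else tens 1 v * G₂ - 1
  have he1 : 1 + e true = tens 1 v * G₁ := by simp [e]
  have he2 : 1 + e false = tens 1 v * G₂ := by simp [e]
  have hmem1 : ∀ G' : Matrix n n B, G' - 1 ∈ Ψ.F 1 → tens 1 v * G' - 1 ∈ Ψ.F 1 := by
    intro G' hG'
    have h1 : tens 1 v * G' - 1 = tens 1 v * (G' - 1) + tens 1 (v - 1) := by
      rw [tens_sub, tens_one_one]; noncomm_ring
    rw [h1]
    exact add_mem (NilFiltration.mul_mem_right (tens_mem hv0 1) hG') (tens_mem hv1 1)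
  have heF : ∀ b, e b ∈ Ψ.F 1 := by
    rintro (_ | _)
    · exact hmem1 G₂ hG₂1
    · exact hmem1 G₁ hG₁1
  have he0 : ∀ b, expect φ (e b) = 0 := by
    rintro (_ | _)
    · simp [e, expect_tens_one_mul, hEG₂, hvw, expect_one]
    · simp [e, expect_tens_one_mul, hEG₁, hvw, expect_one]
  have heS : ∀ b i j, e b i j ∈ Algebra.adjoin ℂ (if b then S else T) := by
    rintro (_ | _) i j
    · simp only [Bool.false_eq_true, if_false, e, Matrix.sub_apply]
      exact sub_mem (mul_apply_mem (tens_apply_mem (one_mem _) v)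
        (hG₂S _ fun l => Algebra.subset_adjoin (hy l)) i j) (one_apply_mem _ i j)
    · simp only [if_true, e, Matrix.sub_apply]
      exact sub_mem (mul_apply_mem (tens_apply_mem (one_mem _) v)
        (hG₁S _ fun l => Algebra.subset_adjoin (hx l)) i j) (one_apply_mem _ i j)
  set P := ∑ k ∈ range Ψ.K, altProd e true (k + 1) with hP
  set Q := ∑ k ∈ range Ψ.K, altProd e false (k + 1) with hQ
  have hPQ : P = e true * (1 + Q) := sum_altProd Ψ e heF true
  have hQP : Q = e false * (1 + P) := sum_altProd Ψ e heF false
  have hEP : expect φ P = 0 := by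
    rw [hP, map_sum]
    exact sum_eq_zero fun k _ => expect_altProd φ hfree e heS he0 true k
  have hEQ : expect φ Q = 0 := by
    rw [hQ, map_sum]
    exact sum_eq_zero fun k _ => expect_altProd φ hfree e heS he0 false k
  set X := ∑ l, tens (x l) (Λ l) with hX
  set Y := ∑ l, tens (y l) (Λ' l) with hY
  have hwv' : tens 1 w * tens 1 v = (1 : Matrix n n B) := by
    rw [tens_mul_tens, hwv, one_mul, tens_one_one]
  have h1 : (1 - tens 1 (a' * v) - X) * (tens 1 w * (1 + P + Q)) = 1 + Q := by
    have h2 : 1 + P + Q = tens 1 v * G₁ * (1 + Q) := by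
      rw [← he1, add_mul, one_mul, ← hPQ]; abel
    calc (1 - tens 1 (a' * v) - X) * (tens 1 w * (1 + P + Q))
        = (1 - tens 1 (a' * v) - X) * ((tens 1 w * tens 1 v) * G₁) * (1 + Q) := by
          rw [h2]; noncomm_ring
      _ = _ := by rw [hwv', one_mul, hG₁, one_mul]
  have h2 : (1 - tens 1 (a * v) - Y) * (tens 1 w * (1 + P + Q)) = 1 + P := by
    have h2 : 1 + P + Q = tens 1 v * G₂ * (1 + P) := by
      rw [← he2, add_mul, one_mul, ← hQP]
    calc (1 - tens 1 (a * v) - Y) * (tens 1 w * (1 + P + Q))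
        = (1 - tens 1 (a * v) - Y) * ((tens 1 w * tens 1 v) * G₂) * (1 + P) := by
          rw [h2]; noncomm_ring
      _ = _ := by rw [hwv', one_mul, hG₂, one_mul]
  have h3 : (1 - (X + Y)) * (tens 1 w * (1 + P + Q)) = 1 := by
    have h4 : tens (1 : B) v = 1 - tens 1 (a * v) - tens 1 (a' * v) := by
      rw [← tens_one_one, ← tens_sub, ← tens_sub, ← hv]
    have h5 : tens 1 v * (tens 1 w * (1 + P + Q)) = 1 + P + Q := by
      rw [← mul_assoc, tens_mul_tens, hvw, one_mul, tens_one_one, one_mul]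
    calc (1 - (X + Y)) * (tens 1 w * (1 + P + Q))
        = (1 - tens 1 (a' * v) - X) * (tens 1 w * (1 + P + Q)) +
          (1 - tens 1 (a * v) - Y) * (tens 1 w * (1 + P + Q)) -
          (1 - tens 1 (a * v) - tens 1 (a' * v)) * (tens 1 w * (1 + P + Q)) := by noncomm_ring
      _ = 1 := by rw [h1, h2, ← h4, h5]; abel
  have h4 : G = tens 1 w * (1 + P + Q) := by
    calc G = G * ((1 - (X + Y)) * (tens 1 w * (1 + P + Q))) := by rw [h3, mul_one]
      _ = _ := by rw [← mul_assoc, hG, one_mul]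
  rw [h4, expect_tens_one_mul, map_add, map_add, expect_one, hEP, hEQ, add_zero, add_zero, mul_one]

end Matrices

/-! ### Power series at nilpotent elements -/

namespace NilFiltration

variable {R : Type*} [Ring R] [Algebra ℂ R] (Φ : NilFiltration R)

theorem aeval_trunc_coe {u : R} (hu : u ∈ Φ.F 1) (p : Polynomial ℂ) :
    Polynomial.aeval u (PowerSeries.trunc Φ.K (p : PowerSeries ℂ)) = Polynomial.aeval u p := by
  rw [eq_comm, ← sub_eq_zero, ← map_sub]
  have h1 : (Polynomial.X : Polynomial ℂ) ^ Φ.K ∣ p - PowerSeries.trunc Φ.K (p : PowerSeries ℂ) := by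
    rw [Polynomial.X_pow_dvd_iff]
    intro d hd
    rw [Polynomial.coeff_sub, PowerSeries.coeff_trunc, if_pos hd, Polynomial.coeff_coe, sub_self]
  obtain ⟨q, hq⟩ := h1
  rw [hq, map_mul, map_pow, Polynomial.aeval_X, Φ.pow_eq_zero hu le_rfl, zero_mul]

/-- Evaluation of formal power series at an element of `F 1`. -/
noncomputable def evalAt {u : R} (hu : u ∈ Φ.F 1) : PowerSeries ℂ →ₐ[ℂ] R :=
  AlgHom.ofLinearMap
    { toFun := fun f => Polynomial.aeval u (PowerSeries.trunc Φ.K f)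
      map_add' := fun f g => by rw [map_add, map_add]
      map_smul' := fun c f => by rw [map_smul, map_smul, RingHom.id_apply] }
    (by
      have h := Φ.aeval_trunc_coe hu 1
      rwa [map_one, Polynomial.coe_one] at h)
    (fun f g => by
      change Polynomial.aeval u (PowerSeries.trunc Φ.K (f * g)) =
        Polynomial.aeval u (PowerSeries.trunc Φ.K f) * Polynomial.aeval u (PowerSeries.trunc Φ.K g)
      rw [← PowerSeries.trunc_trunc_mul_trunc, ← Polynomial.coe_mul, Φ.aeval_trunc_coe hu, map_mul])

theorem evalAt_apply {u : R} (hu : u ∈ Φ.F 1) (f : PowerSeries ℂ) :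
    Φ.evalAt hu f = ∑ k ∈ range Φ.K, PowerSeries.coeff k f • u ^ k := by
  change Polynomial.aeval u (PowerSeries.trunc Φ.K f) = _
  rw [Polynomial.aeval_def, PowerSeries.eval₂_trunc_eq_sum_range]
  simp only [Algebra.smul_def]

theorem evalAt_coe {u : R} (hu : u ∈ Φ.F 1) (p : Polynomial ℂ) :
    Φ.evalAt hu (p : PowerSeries ℂ) = Polynomial.aeval u p := Φ.aeval_trunc_coe hu p

theorem evalAt_congr {u u' : R} (h : u = u') (hu : u ∈ Φ.F 1) (hu' : u' ∈ Φ.F 1)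
    (f : PowerSeries ℂ) : Φ.evalAt hu f = Φ.evalAt hu' f := by
  subst h; rfl

theorem evalAt_X {u : R} (hu : u ∈ Φ.F 1) : Φ.evalAt hu PowerSeries.X = u := by
  rw [← Polynomial.coe_X, evalAt_coe, Polynomial.aeval_X]

theorem evalAt_X_mul {u : R} (hu : u ∈ Φ.F 1) (f : PowerSeries ℂ) :
    Φ.evalAt hu (PowerSeries.X * f) = u * Φ.evalAt hu f := by
  rw [map_mul, evalAt_X]

theorem evalAt_mem_zero {u : R} (hu : u ∈ Φ.F 1) (f : PowerSeries ℂ) : Φ.evalAt hu f ∈ Φ.F 0 := by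
  rw [evalAt_apply]
  exact sum_mem fun k _ => Submodule.smul_mem _ _ (mem_of_le (Nat.zero_le k) (pow_mem hu k))

theorem evalAt_mem_one {u : R} (hu : u ∈ Φ.F 1) {f : PowerSeries ℂ}
    (hf : PowerSeries.constantCoeff f = 0) : Φ.evalAt hu f ∈ Φ.F 1 := by
  obtain ⟨f', rfl⟩ := PowerSeries.X_dvd_iff.2 hf
  rw [evalAt_X_mul]
  exact mul_mem_left hu (Φ.evalAt_mem_zero hu f')

theorem evalAt_subst {u : R} (hu : u ∈ Φ.F 1) {g : PowerSeries ℂ}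
    (hg : PowerSeries.constantCoeff g = 0) (f : PowerSeries ℂ) :
    Φ.evalAt hu (PowerSeries.subst g f) = Φ.evalAt (Φ.evalAt_mem_one hu hg) f := by
  have hs : PowerSeries.HasSubst g := PowerSeries.HasSubst.of_constantCoeff_zero' hg
  obtain ⟨h, hh⟩ : (PowerSeries.X : PowerSeries ℂ) ^ Φ.K ∣ f - PowerSeries.trunc Φ.K f := by
    rw [PowerSeries.X_pow_dvd_iff]
    intro d hd
    rw [map_sub, Polynomial.coeff_coe, PowerSeries.coeff_trunc, if_pos hd, sub_self]
  obtain ⟨p, hp⟩ : ∃ p, p = PowerSeries.trunc Φ.K f := ⟨_, rfl⟩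
  have hf : f = (p : PowerSeries ℂ) + PowerSeries.X ^ Φ.K * h := by rw [← hh, hp]; ring
  rw [hf, PowerSeries.subst_add hs, PowerSeries.subst_mul hs, PowerSeries.subst_pow hs,
    PowerSeries.subst_X hs, PowerSeries.subst_coe hs, map_add, map_add, map_mul, map_pow,
    Φ.pow_eq_zero (Φ.evalAt_mem_one hu hg) le_rfl, map_mul, map_pow, evalAt_X,
    Φ.pow_eq_zero (Φ.evalAt_mem_one hu hg) le_rfl, evalAt_coe, Polynomial.aeval_algHom_apply]
  simp

/-- Evaluation is compatible with intertwining relations. -/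
theorem mul_evalAt {u u' : R} (hu : u ∈ Φ.F 1) (hu' : u' ∈ Φ.F 1) {a : R} (h : a * u = u' * a)
    (f : PowerSeries ℂ) : a * Φ.evalAt hu f = Φ.evalAt hu' f * a := by
  have hk : ∀ k, a * u ^ k = u' ^ k * a := by
    intro k
    induction k with
    | zero => simp
    | succ k ih => rw [pow_succ, ← mul_assoc, ih, mul_assoc, h, ← mul_assoc, ← pow_succ]
  rw [evalAt_apply, evalAt_apply, mul_sum, sum_mul]
  exact sum_congr rfl fun k _ => by rw [mul_smul_comm, smul_mul_assoc, hk]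

theorem evalAt_mul_of_mul_eq {u r : R} (hu : u ∈ Φ.F 1) (hr : r ∈ Φ.F 1) {e : R}
    (h : u * e = r * e) (hre : Commute r e) (f : PowerSeries ℂ) :
    Φ.evalAt hu f * e = Φ.evalAt hr f * e := by
  have hk : ∀ k, u ^ k * e = r ^ k * e := by
    intro k
    induction k with
    | zero => simp
    | succ k ih =>
      rw [pow_succ', mul_assoc, ih, (hre.pow_left k).eq, ← mul_assoc, h, mul_assoc,
        ← (hre.pow_left k).eq, ← mul_assoc, ← pow_succ']
  rw [evalAt_apply, evalAt_apply, sum_mul, sum_mul]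
  exact sum_congr rfl fun k _ => by rw [smul_mul_assoc, smul_mul_assoc, hk]

theorem mul_evalAt_of_mul_eq_self {u : R} (hu : u ∈ Φ.F 1) {e : R} (h : e * u = u)
    {f : PowerSeries ℂ} (hf : PowerSeries.constantCoeff f = 0) :
    e * Φ.evalAt hu f = Φ.evalAt hu f := by
  obtain ⟨f', rfl⟩ := PowerSeries.X_dvd_iff.2 hf
  rw [evalAt_X_mul, ← mul_assoc, h]

theorem mul_evalAt_of_mul_eq_zero {u : R} (hu : u ∈ Φ.F 1) {e : R} (h : e * u = 0)
    {f : PowerSeries ℂ} (hf : PowerSeries.constantCoeff f = 0) :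
    e * Φ.evalAt hu f = 0 := by
  obtain ⟨f', rfl⟩ := PowerSeries.X_dvd_iff.2 hf
  rw [evalAt_X_mul, ← mul_assoc, h, zero_mul]

theorem evalAt_sub_mem {u u' : R} (hu : u ∈ Φ.F 1) (hu' : u' ∈ Φ.F 1) {d : ℕ}
    (h : u - u' ∈ Φ.F d) (f : PowerSeries ℂ) : Φ.evalAt hu f - Φ.evalAt hu' f ∈ Φ.F d := by
  have hk : ∀ k, u ^ k - u' ^ k ∈ Φ.F d := by
    intro k
    induction k with
    | zero => simp
    | succ k ih =>
      have h1 : u ^ (k + 1) - u' ^ (k + 1) = u ^ k * (u - u') + (u ^ k - u' ^ k) * u' := by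
        rw [pow_succ, pow_succ]; noncomm_ring
      rw [h1]
      exact add_mem (mul_mem_right (mem_of_le (Nat.zero_le k) (pow_mem hu k)) h)
        (mul_mem_left ih (mem_of_le zero_le_one hu'))
  rw [evalAt_apply, evalAt_apply, ← sum_sub_distrib]
  refine sum_mem fun k _ => ?_
  rw [← smul_sub]
  exact Submodule.smul_mem _ _ (hk k)

/-- Over a one-letter alphabet, sums over words are power series. -/
theorem wordSum_unit {u : R} (hu : u ∈ Φ.F 1) (f : List Unit → ℂ) :
    wordSum (fun _ : Unit => u) Φ.K f =
      Φ.evalAt hu (PowerSeries.mk fun n => f (List.replicate n ())) := by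
  have key : ∀ (k : ℕ) (f : List Unit → ℂ), wordSum (fun _ : Unit => u) k f =
      ∑ n ∈ range k, f (List.replicate n ()) • u ^ n := by
    intro k
    induction k with
    | zero => intro f; simp [wordSum]
    | succ k ih =>
      intro f
      rw [wordSum, sum_range_succ', add_comm]
      simp [ih, mul_sum, pow_succ', List.replicate_succ]
  rw [key, evalAt_apply]
  simp only [PowerSeries.coeff_mk]

/-! ### The `R`-transform of an `R`-diagonal distribution -/

instance : DecidableEq StarLetter
  | .one, .one => isTrue rfl
  | .star, .star => isTrue rfl
  | .one, .star => isFalse (by simp)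
  | .star, .one => isFalse (by simp)

instance : Fintype StarLetter := ⟨{.one, .star}, fun l => by cases l <;> simp⟩

theorem sum_starLetter {M : Type*} [AddCommMonoid M] (f : StarLetter → M) :
    ∑ l, f l = f .one + f .star := by
  change ∑ l ∈ {StarLetter.one, StarLetter.star}, f l = _
  rw [sum_pair (by simp)]

/-- The other letter. -/
def starFlip : StarLetter → StarLetter
  | .one => .star
  | .star => .one

/-- The alternating word of length `k` with first letter `l`. -/
def altWord : StarLetter → ℕ → List StarLetter
  | _, 0 => []
  | l, k + 1 => l :: altWord (starFlip l) k

theorem length_altWord (l : StarLetter) (k : ℕ) : (altWord l k).length = k := by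
  induction k generalizing l with
  | zero => rfl
  | succ k ih => simp [altWord, ih]

theorem altWord_one_two_mul (n : ℕ) : altWord .one (2 * n) = StarDistribution.altOneStar n := by
  induction n with
  | zero => rfl
  | succ n ih =>
    rw [StarDistribution.altOneStar] at ih ⊢
    rw [List.replicate_succ, List.flatten_cons, ← ih]
    rfl

theorem altWord_star_two_mul (n : ℕ) : altWord .star (2 * n) = StarDistribution.altStarOne n := by
  induction n with
  | zero => rfl
  | succ n ih =>
    rw [StarDistribution.altStarOne] at ih ⊢
    rw [List.replicate_succ, List.flatten_cons, ← ih]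
    rfl

omit [Algebra ℂ R] in
theorem prod_map_altWord (M : StarLetter → R) (l : StarLetter) (n : ℕ) :
    ((altWord l (2 * n)).map M).prod = (M l * M (starFlip l)) ^ n := by
  induction n with
  | zero => simp [altWord]
  | succ n ih =>
    have h : starFlip (starFlip l) = l := by cases l <;> rfl
    rw [pow_succ', ← ih, mul_add, mul_one]
    simp only [altWord, h, List.map_cons, List.prod_cons, mul_assoc]

theorem wordSum_of_altWord (M : StarLetter → R) (k : ℕ) : ∀ (l : StarLetter) (f : List StarLetter → ℂ),
    (∀ t, t ≠ altWord l t.length → f t = 0) →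
    wordSum M k f = ∑ n ∈ range k, f (altWord l n) • ((altWord l n).map M).prod := by
  induction k with
  | zero => intro l f _; simp [wordSum]
  | succ k ih =>
    intro l f hf
    have h1 := ih (starFlip l) (fun t => f (l :: t)) (fun t ht => hf _ fun h => ht (by
      simpa [altWord] using h))
    have h2 : (fun t => f (starFlip l :: t)) = fun _ => 0 := funext fun t => hf _ fun h => by
      cases l <;> simp [altWord, starFlip] at h
    have h3 : ∑ l', M l' * wordSum M k (fun t => f (l' :: t)) =
        M l * wordSum M k (fun t => f (l :: t)) := by
      rw [sum_starLetter]
      cases l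
      · rw [starFlip] at h2
        rw [h2, wordSum_zero, mul_zero, add_zero]
      · rw [starFlip] at h2
        rw [h2, wordSum_zero, mul_zero, zero_add]
    rw [wordSum, h3, h1, sum_range_succ', add_comm, mul_sum]
    simp [altWord]

theorem sum_range_two_mul {M : Type*} [AddCommMonoid M] (h : ℕ → M) (k : ℕ) :
    ∑ n ∈ range (2 * k), h n = ∑ n ∈ range k, (h (2 * n) + h (2 * n + 1)) := by
  induction k with
  | zero => simp
  | succ k ih => rw [mul_add, mul_one, sum_range_succ, sum_range_succ, ih, sum_range_succ, add_assoc]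

theorem wordSum_of_altWord_even {M : StarLetter → R} (hM : ∀ l, M l ∈ Φ.F 1) (l : StarLetter)
    (f : List StarLetter → ℂ) (hf : ∀ t, t ≠ altWord l t.length → f t = 0)
    (hodd : ∀ n, f (altWord l (2 * n + 1)) = 0) (h : M l * M (starFlip l) ∈ Φ.F 1) :
    wordSum M Φ.K f = Φ.evalAt h (PowerSeries.mk fun n => f (altWord l (2 * n))) := by
  have h1 := Φ.eq_zero (Φ.wordSum_sub_mem_of_le hM (Nat.le_mul_of_pos_left Φ.K two_pos) f)
  rw [← sub_eq_zero.1 h1, wordSum_of_altWord M _ l f hf, sum_range_two_mul, evalAt_apply]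
  refine sum_congr rfl fun n _ => ?_
  rw [hodd, zero_smul, add_zero, PowerSeries.coeff_mk, prod_map_altWord]

/-- The `R`-transform of an `R`-diagonal pair, at non-commuting arguments, in terms of the two
determining sequences. -/
theorem wordSum_of_alternating {M : StarLetter → R} (hM : ∀ l, M l ∈ Φ.F 1)
    (κ : List StarLetter → ℂ) (h0 : κ [] = 0)
    (hκ : ∀ w, w ≠ [] → ¬ StarDistribution.IsAlternating w → κ w = 0)
    (h : M .one * M .star ∈ Φ.F 1) (h' : M .star * M .one ∈ Φ.F 1) :
    wordSum M Φ.K κ =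
      Φ.evalAt h (PowerSeries.mk fun n => κ (StarDistribution.altOneStar n)) +
      Φ.evalAt h' (PowerSeries.mk fun n => κ (StarDistribution.altStarOne n)) := by
  let part : StarLetter → List StarLetter → ℂ := fun l t =>
    if t = altWord l t.length then κ t else 0
  have hpart : ∀ l t, t ≠ altWord l t.length → part l t = 0 := fun l t ht => if_neg ht
  have hpart' : ∀ l n, part l (altWord l n) = κ (altWord l n) := fun l n =>
    if_pos (by rw [length_altWord])
  have hodd : ∀ l n, part l (altWord l (2 * n + 1)) = 0 := by
    intro l n
    rw [hpart']
    refine hκ _ (by simp [altWord]) ?_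
    rintro ⟨k, -, hk⟩
    rw [← altWord_one_two_mul, ← altWord_star_two_mul] at hk
    have h1 : 2 * n + 1 = 2 * k := by
      rcases hk with hk | hk <;> simpa [length_altWord] using congrArg List.length hk
    omega
  have hsum : κ = fun t => part .one t + part .star t := by
    funext t
    match t with
    | [] => simp [part, h0]
    | .one :: t =>
      have h1 : part .star (.one :: t) = 0 := if_neg (by simp [altWord])
      rw [h1, add_zero]
      by_cases h2 : (StarLetter.one :: t) = altWord .one (StarLetter.one :: t).length
      · exact (if_pos h2).symm
      · refine (hκ _ (by simp) ?_).trans (if_neg h2).symm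
        rintro ⟨k, -, hk⟩
        rw [← altWord_one_two_mul, ← altWord_star_two_mul] at hk
        rcases hk with hk | hk
        · exact h2 (by rw [hk, length_altWord])
        · cases k <;> simp [altWord, mul_add] at hk
    | .star :: t =>
      have h1 : part .one (.star :: t) = 0 := if_neg (by simp [altWord])
      rw [h1, zero_add]
      by_cases h2 : (StarLetter.star :: t) = altWord .star (StarLetter.star :: t).length
      · exact (if_pos h2).symm
      · refine (hκ _ (by simp) ?_).trans (if_neg h2).symm
        rintro ⟨k, -, hk⟩
        rw [← altWord_one_two_mul, ← altWord_star_two_mul] at hk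
        rcases hk with hk | hk
        · cases k <;> simp [altWord, mul_add] at hk
        · exact h2 (by rw [hk, length_altWord])
  conv_lhs => rw [hsum]
  rw [wordSum_add, Φ.wordSum_of_altWord_even hM .one _ (hpart _) (hodd _) h,
    Φ.wordSum_of_altWord_even hM .star _ (hpart _) (hodd _) h']
  simp only [hpart']
  simp only [altWord_one_two_mul, altWord_star_two_mul]
  rfl

end NilFiltration

open PowerSeries

namespace NilFiltration

variable {R : Type*} [Ring R] [Algebra ℂ R] (Φ : NilFiltration R)

/-! ### Subordination for a product of free `R`-diagonal elements -/

/-- The arguments at which the `R`-transforms are evaluated, for the pencil that linearises the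
product `a b` of two free elements with determining series `A`, `B` and `A'`, `B'`. Here `x`, `x'`, `z`,
`z'` are the coefficients of `a`, `a*`, `b`, `b*` in the pencil; the idempotents `e₀`, `e₁`, `e₂` stand
for the places between two factors `a b` or `b* a*`, between `a` and `b`, and between `b*` and `a*`. -/
theorem subordination_of_block {e₀ e₁ e₂ x x' z z' W : R}
    (h10 : e₁ * e₀ = 0) (h20 : e₂ * e₀ = 0) (h01 : e₀ * e₁ = 0) (h02 : e₀ * e₂ = 0)
    (h12 : e₁ * e₂ = 0) (h21 : e₂ * e₁ = 0)
    (hx : e₀ * x = x) (hx₁ : x * e₁ = x) (hz : e₁ * z = z) (hz' : e₀ * z' = z')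
    (hz₂ : z' * e₂ = z') (hx' : e₂ * x' = x')
    {A B A' B' A₁ B₁ : PowerSeries ℂ}
    (hA : constantCoeff A = 0) (hB' : constantCoeff B' = 0)
    (hA₁ : A' = X * A₁) (hB₁ : B = X * B₁)
    (hU : x * W * (x' * W) ∈ Φ.F 1) (hUt : x' * W * (x * W) ∈ Φ.F 1)
    (hVt : z * W * (z' * W) ∈ Φ.F 1) (hV : z' * W * (z * W) ∈ Φ.F 1)
    (hW : W = 1 + (Φ.evalAt hU A + Φ.evalAt hUt B) + (Φ.evalAt hVt A' + Φ.evalAt hV B')) :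
    e₀ * W = e₀ + Φ.evalAt hU A + Φ.evalAt hV B' ∧
    x * W * (x' * W) =
      x * z * W * Φ.evalAt hV A₁ * (z' * x' * W) * (1 + Φ.evalAt hU B) ∧
    z' * W * (z * W) =
      z' * x' * W * Φ.evalAt hU B₁ * (x * z * W) * (1 + Φ.evalAt hV A') := by
  have hB : constantCoeff B = 0 := by rw [hB₁]; simp
  have hA' : constantCoeff A' = 0 := by rw [hA₁]; simp
  have absorb : ∀ {e a : R}, e * a = a → ∀ b, e * (a * b) = a * b := fun h b => by
    rw [← mul_assoc, h]
  have kill : ∀ {e f a : R}, e * f = 0 → f * a = a → ∀ b, e * (a * b) = 0 := fun h h' b => by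
    rw [← h', ← mul_assoc, ← mul_assoc, h, zero_mul, zero_mul]
  have hW0 : e₀ * W = e₀ + Φ.evalAt hU A + Φ.evalAt hV B' := by
    conv_lhs => rw [hW]
    simp only [mul_add, mul_one]
    rw [Φ.mul_evalAt_of_mul_eq_self hU (by rw [mul_assoc]; exact absorb hx _) hA,
      Φ.mul_evalAt_of_mul_eq_zero hUt (by rw [mul_assoc]; exact kill h02 hx' _) hB,
      Φ.mul_evalAt_of_mul_eq_zero hVt (by rw [mul_assoc]; exact kill h01 hz _) hA',
      Φ.mul_evalAt_of_mul_eq_self hV (by rw [mul_assoc]; exact absorb hz' _) hB']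
    abel
  have hW1 : e₁ * W = e₁ + Φ.evalAt hVt A' := by
    conv_lhs => rw [hW]
    simp only [mul_add, mul_one]
    rw [Φ.mul_evalAt_of_mul_eq_zero hU (by rw [mul_assoc]; exact kill h10 hx _) hA,
      Φ.mul_evalAt_of_mul_eq_zero hUt (by rw [mul_assoc]; exact kill h12 hx' _) hB,
      Φ.mul_evalAt_of_mul_eq_self hVt (by rw [mul_assoc]; exact absorb hz _) hA',
      Φ.mul_evalAt_of_mul_eq_zero hV (by rw [mul_assoc]; exact kill h10 hz' _) hB']
    abel
  have hW2 : e₂ * W = e₂ + Φ.evalAt hUt B := by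
    conv_lhs => rw [hW]
    simp only [mul_add, mul_one]
    rw [Φ.mul_evalAt_of_mul_eq_zero hU (by rw [mul_assoc]; exact kill h20 hx _) hA,
      Φ.mul_evalAt_of_mul_eq_self hUt (by rw [mul_assoc]; exact absorb hx' _) hB,
      Φ.mul_evalAt_of_mul_eq_zero hVt (by rw [mul_assoc]; exact kill h21 hz _) hA',
      Φ.mul_evalAt_of_mul_eq_zero hV (by rw [mul_assoc]; exact kill h20 hz' _) hB']
    abel
  -- `x' W (x W x' W) = (x' W x W) x' W`, and likewise for `z`
  have ix : x' * W * Φ.evalAt hU B = Φ.evalAt hUt B * (x' * W) :=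
    Φ.mul_evalAt hU hUt (by noncomm_ring) B
  have iz : z * W * Φ.evalAt hV A' = Φ.evalAt hVt A' * (z * W) :=
    Φ.mul_evalAt hV hVt (by noncomm_ring) A'
  have ix₁ : x' * W * Φ.evalAt hU B₁ = Φ.evalAt hUt B₁ * (x' * W) :=
    Φ.mul_evalAt hU hUt (by noncomm_ring) B₁
  have iz₁ : z * W * Φ.evalAt hV A₁ = Φ.evalAt hVt A₁ * (z * W) :=
    Φ.mul_evalAt hV hVt (by noncomm_ring) A₁
  have hW22 : e₂ * W * (x' * W) = x' * W * (1 + Φ.evalAt hU B) := by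
    rw [hW2, add_mul, ← ix, absorb hx']
    noncomm_ring
  have hW11 : e₁ * W * (z * W) = z * W * (1 + Φ.evalAt hV A') := by
    rw [hW1, add_mul, ← iz, absorb hz]
    noncomm_ring
  have hW12 : e₁ * W * e₂ = z * W * Φ.evalAt hV A₁ * (z' * W) * e₂ := by
    have h1 : Φ.evalAt hVt A' = Φ.evalAt hVt A₁ * (z * W * (z' * W)) := by
      rw [hA₁, mul_comm, map_mul, evalAt_X]
    rw [hW1, add_mul, h12, zero_add, h1, iz₁]
    noncomm_ring
  have hW21 : e₂ * W * e₁ = x' * W * Φ.evalAt hU B₁ * (x * W) * e₁ := by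
    have h1 : Φ.evalAt hUt B = Φ.evalAt hUt B₁ * (x' * W * (x * W)) := by
      rw [hB₁, mul_comm, map_mul, evalAt_X]
    rw [hW2, add_mul, h21, zero_add, h1, ix₁]
    noncomm_ring
  refine ⟨hW0, ?_, ?_⟩
  · calc x * W * (x' * W) = x * (e₁ * W * e₂) * (x' * W) := by
          nth_rewrite 1 [← hx₁, ← hx']; noncomm_ring
      _ = x * z * W * Φ.evalAt hV A₁ * z' * (e₂ * W * (x' * W)) := by
          rw [hW12]
          have h2 : z' * (e₂ * W * (x' * W)) = z' * W * e₂ * (x' * W) := by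
            calc z' * (e₂ * W * (x' * W)) = (z' * e₂) * W * (x' * W) := by noncomm_ring
              _ = z' * W * (e₂ * x') * W := by rw [hz₂, hx']; noncomm_ring
              _ = _ := by noncomm_ring
          calc _ = x * z * W * Φ.evalAt hV A₁ * (z' * W * e₂ * (x' * W)) := by noncomm_ring
            _ = _ := by rw [← h2]; noncomm_ring
      _ = _ := by rw [hW22]; noncomm_ring
  · calc z' * W * (z * W) = z' * (e₂ * W * e₁) * (z * W) := by
          nth_rewrite 1 [← hz₂, ← hz]; noncomm_ring
      _ = z' * x' * W * Φ.evalAt hU B₁ * x * (e₁ * W * (z * W)) := by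
          rw [hW21]
          have h2 : x * (e₁ * W * (z * W)) = x * W * e₁ * (z * W) := by
            calc x * (e₁ * W * (z * W)) = (x * e₁) * W * (z * W) := by noncomm_ring
              _ = x * W * (e₁ * z) * W := by rw [hx₁, hz]; noncomm_ring
              _ = _ := by noncomm_ring
          calc _ = z' * x' * W * Φ.evalAt hU B₁ * (x * W * e₁ * (z * W)) := by noncomm_ring
            _ = _ := by rw [← h2]; noncomm_ring
      _ = _ := by rw [hW11]; noncomm_ring

/-- The subordination equations have a unique solution, given by power series `θ`, `η` in one variable
that solve their commutative analogue. -/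
theorem subordination_unique {y y' W U V : R} (hy : y ∈ Φ.F 1) (hy' : y' ∈ Φ.F 1)
    (hW : W ∈ Φ.F 0) (hU : U ∈ Φ.F 1) (hV : V ∈ Φ.F 1)
    (hs : y * W * (y' * W) ∈ Φ.F 1) (ht : y' * W * (y * W) ∈ Φ.F 1)
    {A' B A₁ B₁ θ η : PowerSeries ℂ}
    (hθ0 : constantCoeff θ = 0) (hη0 : constantCoeff η = 0)
    (hθ : θ = X * subst η A₁ * (1 + subst θ B)) (hη : η = X * subst θ B₁ * (1 + subst η A'))
    (hUeq : U = y * W * Φ.evalAt hV A₁ * (y' * W) * (1 + Φ.evalAt hU B))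
    (hVeq : V = y' * W * Φ.evalAt hU B₁ * (y * W) * (1 + Φ.evalAt hV A')) :
    U = Φ.evalAt hs θ ∧ V = Φ.evalAt ht η := by
  have hu : Φ.evalAt hs θ ∈ Φ.F 1 := Φ.evalAt_mem_one hs hθ0
  have hv : Φ.evalAt ht η ∈ Φ.F 1 := Φ.evalAt_mem_one ht hη0
  have hueq : Φ.evalAt hs θ =
      y * W * Φ.evalAt hv A₁ * (y' * W) * (1 + Φ.evalAt hu B) := by
    have h1 := Φ.mul_evalAt ht hs (a := y * W) (by noncomm_ring) (subst η A₁)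
    rw [← Φ.evalAt_subst ht hη0, ← Φ.evalAt_subst hs hθ0, h1]
    nth_rewrite 1 [hθ]
    rw [mul_comm X, map_mul, map_mul, evalAt_X, map_add, map_one]
    noncomm_ring
  have hveq : Φ.evalAt ht η =
      y' * W * Φ.evalAt hu B₁ * (y * W) * (1 + Φ.evalAt hv A') := by
    have h1 := Φ.mul_evalAt hs ht (a := y' * W) (by noncomm_ring) (subst θ B₁)
    rw [← Φ.evalAt_subst hs hθ0, ← Φ.evalAt_subst ht hη0, h1]
    nth_rewrite 1 [hη]
    rw [mul_comm X, map_mul, map_mul, evalAt_X, map_add, map_one]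
    noncomm_ring
  -- one application of the contraction
  have step : ∀ {p p' c c' q q' : R} {d : ℕ}, p ∈ Φ.F 1 → p' ∈ Φ.F 0 → c ∈ Φ.F 0 →
      q' ∈ Φ.F 0 → c - c' ∈ Φ.F d → q - q' ∈ Φ.F d →
      p * c * p' * (1 + q) - p * c' * p' * (1 + q') ∈ Φ.F (d + 1) := by
    intro p p' c c' q q' d hp hp' hc hq' hcc hqq
    have h1 : p * c * p' * (1 + q) - p * c' * p' * (1 + q') =
        p * (c * p' * (q - q') + (c - c') * (p' * (1 + q'))) := by noncomm_ring
    rw [h1]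
    exact mul_mem_succ hp (add_mem (mul_mem_right (mul_mem_right hc hp') hqq)
      (mul_mem_left hcc (mul_mem_right hp' (add_mem Φ.one_mem hq'))))
  have hyW : y * W ∈ Φ.F 1 := mul_mem_left hy hW
  have hyW' : y' * W ∈ Φ.F 1 := mul_mem_left hy' hW
  have key : ∀ k, U - Φ.evalAt hs θ ∈ Φ.F k ∧ V - Φ.evalAt ht η ∈ Φ.F k := by
    intro k
    induction k with
    | zero => exact ⟨mem_of_le zero_le_one (sub_mem hU hu), mem_of_le zero_le_one (sub_mem hV hv)⟩
    | succ k ih =>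
      constructor
      · have h1 := step hyW (mem_of_le zero_le_one hyW') (Φ.evalAt_mem_zero hV A₁)
          (Φ.evalAt_mem_zero hu B) (Φ.evalAt_sub_mem hV hv ih.2 A₁)
          (Φ.evalAt_sub_mem hU hu ih.1 B)
        rwa [← hUeq, ← hueq] at h1
      · have h1 := step hyW' (mem_of_le zero_le_one hyW) (Φ.evalAt_mem_zero hU B₁)
          (Φ.evalAt_mem_zero hv A') (Φ.evalAt_sub_mem hU hu ih.1 B₁)
          (Φ.evalAt_sub_mem hV hv ih.2 A')
        rwa [← hVeq, ← hveq] at h1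
  exact ⟨sub_eq_zero.1 (Φ.eq_zero (key _).1), sub_eq_zero.1 (Φ.eq_zero (key _).2)⟩

/-- Two solutions of the functional equation of an `R`-diagonal element agree in the corner of an
idempotent `e`. -/
theorem corner_unique {e y y' W V : R} (he : e ∈ Φ.F 0) (hye : y * e = y) (hye' : y' * e = y')
    (hy : y ∈ Φ.F 1) (hy' : y' ∈ Φ.F 1) (hW : W ∈ Φ.F 0) (hV : V ∈ Φ.F 0)
    (hs : y * W * (y' * W) ∈ Φ.F 1) (ht : y' * W * (y * W) ∈ Φ.F 1)
    (hs' : y * V * (y' * V) ∈ Φ.F 1) (ht' : y' * V * (y * V) ∈ Φ.F 1)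
    {f g : PowerSeries ℂ}
    (hWeq : e * W = e + Φ.evalAt hs f + Φ.evalAt ht g)
    (hVeq : e * V = e + Φ.evalAt hs' f + Φ.evalAt ht' g) : e * W = e * V := by
  refine Φ.eq_of_forall (fun k hk => ?_) (sub_mem (mul_mem_right he hW) (mul_mem_right he hV))
  have step : ∀ {p q : R}, p ∈ Φ.F 1 → q ∈ Φ.F 1 → p * e = p → q * e = q →
      p * W * (q * W) - p * V * (q * V) ∈ Φ.F (k + 1) := by
    intro p q hp hq hpe hqe
    have h1 : p * W * (q * W) - p * V * (q * V) =
        p * (e * W - e * V) * (q * W) + p * V * (q * (e * W - e * V)) := by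
      rw [mul_sub, mul_sub, ← mul_assoc p, ← mul_assoc p, ← mul_assoc q, ← mul_assoc q, hpe, hqe]
      noncomm_ring
    rw [h1]
    exact add_mem (mul_mem_left (mul_mem_succ hp hk)
        (mem_of_le zero_le_one (mul_mem_left hq hW)))
      (mul_mem_right (mem_of_le zero_le_one (mul_mem_left hp hV)) (mul_mem_succ hq hk))
  have h1 : e * W - e * V = (Φ.evalAt hs f - Φ.evalAt hs' f) + (Φ.evalAt ht g - Φ.evalAt ht' g) := by
    rw [hWeq, hVeq]; abel
  rw [h1]
  exact add_mem (Φ.evalAt_sub_mem hs hs' (step hy hy' hye hye') f)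
    (Φ.evalAt_sub_mem ht ht' (step hy' hy hye' hye) g)

/-! ### Subordination for a product of two free elements -/

/-- The subordination equations of the product of two free elements with `R`-transforms `B` and `A'`,
in the corner of `e₀`. Here `x`, `z` are the coefficients of the two elements. -/
theorem product_subordination {e₀ e₁ x z W : R} (h00 : e₀ * e₀ = e₀) (h01 : e₀ * e₁ = 0)
    (h10 : e₁ * e₀ = 0)
    (hx : e₀ * x = x) (hx₁ : x * e₁ = x) (hz : e₁ * z = z) (hz₀ : z * e₀ = z)
    {B A' A₁ M P Q : PowerSeries ℂ}
    (hB : constantCoeff B = 0) (hA₁ : A' = X * A₁)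
    (hxW : x * W ∈ Φ.F 1) (hzW : z * W ∈ Φ.F 1) (hs : x * z ∈ Φ.F 1) (ht : z * x ∈ Φ.F 1)
    (hW : W = 1 + Φ.evalAt hxW B + Φ.evalAt hzW A')
    (h₀₀ : e₀ * W * e₀ = Φ.evalAt hs (1 + M) * e₀) (h₁₀ : e₁ * W * e₀ = z * Φ.evalAt hs P * e₀)
    (h₀₁ : e₀ * W * e₁ = x * Φ.evalAt ht Q * e₁) :
    Φ.evalAt hs (1 + M) * e₀ = Φ.evalAt hs (1 + subst (X * P) B) * e₀ ∧
    Φ.evalAt hs (X * P) * e₀ = Φ.evalAt hs (X * subst (X * Q) A₁ * (1 + M)) * e₀ := by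
  have hA' : constantCoeff A' = 0 := by rw [hA₁]; simp
  have hθ0 : constantCoeff (X * P) = 0 := by simp
  have hη0 : constantCoeff (X * Q) = 0 := by simp
  have hcs : ∀ f, Commute (Φ.evalAt hs f) e₀ := fun f => by
    refine (Φ.mul_evalAt hs hs ?_ f).symm
    rw [← mul_assoc, hx, mul_assoc, hz₀]
  have hct : ∀ f, Commute (Φ.evalAt ht f) e₁ := fun f => by
    refine (Φ.mul_evalAt ht ht ?_ f).symm
    rw [← mul_assoc, hz, mul_assoc, hx₁]
  have hu : x * W * e₀ = Φ.evalAt hs (X * P) * e₀ := by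
    calc x * W * e₀ = x * (e₁ * W * e₀) := by nth_rewrite 1 [← hx₁]; noncomm_ring
      _ = _ := by rw [h₁₀, evalAt_X_mul]; noncomm_ring
  have hv : z * W * e₁ = Φ.evalAt ht (X * Q) * e₁ := by
    calc z * W * e₁ = z * (e₀ * W * e₁) := by nth_rewrite 1 [← hz₀]; noncomm_ring
      _ = _ := by rw [h₀₁, evalAt_X_mul]; noncomm_ring
  have hW0 : e₀ * W = e₀ + Φ.evalAt hxW B := by
    conv_lhs => rw [hW]
    rw [mul_add, mul_add, mul_one, Φ.mul_evalAt_of_mul_eq_self hxW (by rw [← mul_assoc, hx]) hB,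
      Φ.mul_evalAt_of_mul_eq_zero hzW (by rw [← hz, ← mul_assoc, ← mul_assoc, h01]; simp) hA',
      add_zero]
  have hW1 : e₁ * W = e₁ + Φ.evalAt hzW A' := by
    conv_lhs => rw [hW]
    rw [mul_add, mul_add, mul_one, Φ.mul_evalAt_of_mul_eq_self hzW (by rw [← mul_assoc, hz]) hA',
      Φ.mul_evalAt_of_mul_eq_zero hxW (by rw [← hx, ← mul_assoc, ← mul_assoc, h10]; simp) hB,
      add_zero]
  constructor
  · rw [← h₀₀, hW0, add_mul, h00,
      Φ.evalAt_mul_of_mul_eq hxW (Φ.evalAt_mem_one hs hθ0) hu (hcs _), ← Φ.evalAt_subst hs hθ0,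
      map_add, map_one, add_mul, one_mul]
  · have h1 : z * W * e₀ = Φ.evalAt ht (1 + M) * z := by
      calc z * W * e₀ = z * (e₀ * W * e₀) := by nth_rewrite 1 [← hz₀]; noncomm_ring
        _ = (z * Φ.evalAt hs (1 + M)) * e₀ := by rw [h₀₀, mul_assoc]
        _ = Φ.evalAt ht (1 + M) * (z * e₀) := by
            rw [Φ.mul_evalAt hs ht (by noncomm_ring), mul_assoc]
        _ = _ := by rw [hz₀]
    have h2 : e₁ * W * e₀ = Φ.evalAt ht (subst (X * Q) A₁ * (1 + M)) * z := by
      calc e₁ * W * e₀ = Φ.evalAt hzW A₁ * (z * W * e₀) := by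
            rw [hW1, add_mul, h10, zero_add, hA₁, mul_comm X, map_mul, evalAt_X, mul_assoc]
        _ = Φ.evalAt hzW A₁ * (e₁ * (z * W * e₀)) := by
            rw [← mul_assoc e₁, ← mul_assoc e₁, hz]
        _ = (Φ.evalAt hzW A₁ * e₁) * (z * W * e₀) := (mul_assoc _ _ _).symm
        _ = (Φ.evalAt ht (subst (X * Q) A₁) * e₁) * (z * W * e₀) := by
            rw [Φ.evalAt_mul_of_mul_eq hzW (Φ.evalAt_mem_one ht hη0) hv (hct _),
              ← Φ.evalAt_subst ht hη0]
        _ = Φ.evalAt ht (subst (X * Q) A₁) * (e₁ * z * W * e₀) := by noncomm_ring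
        _ = _ := by rw [hz, h1, map_mul, mul_assoc]
    calc Φ.evalAt hs (X * P) * e₀ = x * (e₁ * W * e₀) := by
          rw [h₁₀, evalAt_X_mul]; noncomm_ring
      _ = x * (Φ.evalAt ht (subst (X * Q) A₁ * (1 + M)) * (z * e₀)) := by rw [h2, hz₀]
      _ = x * (z * Φ.evalAt hs (subst (X * Q) A₁ * (1 + M)) * e₀) := by
          rw [← mul_assoc (Φ.evalAt ht _) z, ← Φ.mul_evalAt hs ht (by noncomm_ring)]
      _ = _ := by rw [mul_assoc X, evalAt_X_mul]; noncomm_ring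

end NilFiltration

/-! ### Matrices that read off coefficients -/

section Corner

open scoped Kronecker

variable {q : Type*} [Fintype q] [DecidableEq q] {m : Type*} [Fintype m] [DecidableEq m]

/-- The block matrix whose only nonzero block is `T`, in position `(a, b)`. -/
noncomputable def blk (a b : q) (T : Matrix m m ℂ) : Matrix (q × m) (q × m) ℂ :=
  Matrix.single a b 1 ⊗ₖ T

omit [Fintype q] [Fintype m] [DecidableEq m] in
theorem blk_apply (a b : q) (T : Matrix m m ℂ) (i j : q × m) :
    blk a b T i j = if a = i.1 ∧ b = j.1 then T i.2 j.2 else 0 := by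
  rw [blk, Matrix.kroneckerMap_apply, Matrix.single_apply]
  split_ifs <;> simp

omit [DecidableEq m] in
theorem blk_mul (a b c : q) (S T : Matrix m m ℂ) : blk a b S * blk b c T = blk a c (S * T) := by
  rw [blk, blk, ← Matrix.mul_kronecker_mul, Matrix.single_mul_single_same, mul_one]
  rfl

omit [DecidableEq m] in
theorem blk_mul_of_ne {b c : q} (h : b ≠ c) (a d : q) (S T : Matrix m m ℂ) :
    blk a b S * blk c d T = 0 := by
  rw [blk, blk, ← Matrix.mul_kronecker_mul, Matrix.single_mul_single_of_ne (h := h)]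
  exact Matrix.zero_kronecker _

theorem blk_mem {g : q × m → ℕ} {d : ℕ} {a b : q} {T : Matrix m m ℂ}
    (h : ∀ i j, T i j ≠ 0 → g (a, i) + d ≤ g (b, j)) :
    blk a b T ∈ (gradeFiltration g ℂ).F d := by
  rintro ⟨a', i⟩ ⟨b', j⟩ hij
  rw [blk_apply]
  split_ifs with h1
  · obtain ⟨rfl, rfl⟩ := h1
    by_contra h2
    exact absurd (h i j h2) (by omega)
  · rfl

theorem corner_wordSum {ι : Type*} [Fintype ι] (a : q) (T : ι → Matrix m m ℂ) (k : ℕ) :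
    ∀ f : List ι → ℂ, blk a a 1 * wordSum (fun l => blk a a (T l)) k f * blk a a 1 =
      blk a a (wordSum T k f) := by
  induction k with
  | zero =>
    intro f
    simp [wordSum, blk]
  | succ k ih =>
    intro f
    have h1 : ∀ l, blk a a 1 * (blk a a (T l) * wordSum (fun l => blk a a (T l)) k
        (fun t => f (l :: t))) * blk a a 1 =
        blk a a (T l * wordSum T k fun t => f (l :: t)) := by
      intro l
      have h2 : blk a a (T l) = blk a a (T l) * blk a a (1 : Matrix m m ℂ) := by
        rw [blk_mul, mul_one]
      rw [← mul_assoc, blk_mul, one_mul]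
      nth_rewrite 1 [h2]
      rw [mul_assoc, mul_assoc, ← mul_assoc (blk a a 1), ih, blk_mul]
    rw [wordSum, wordSum, mul_add, add_mul, mul_sum, sum_mul, sum_congr rfl fun l _ => h1 l]
    have h3 : ∀ S T : Matrix m m ℂ, blk a a (S + T) = blk a a S + blk a a T := fun S T => by
      rw [blk, Matrix.kronecker_add]; rfl
    have h4 : blk a a (∑ l, T l * wordSum T k fun t => f (l :: t)) =
        ∑ l, blk a a (T l * wordSum T k fun t => f (l :: t)) := by
      ext i j
      rw [Matrix.sum_apply, blk_apply]
      simp only [blk_apply, Matrix.sum_apply]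
      split_ifs <;> simp
    rw [h3, h4]
    congr 1
    rw [mul_smul_comm, mul_one, smul_mul_assoc, blk_mul, mul_one, blk, blk, Matrix.kronecker_smul]

/-- The matrix, indexed by the positions between the letters of a word `w`, that moves from each
occurrence of the letter `l` in `w` to the next position. -/
def letterMatrix {ι : Type*} [DecidableEq ι] (w : List ι) (l : ι) :
    Matrix (Fin (w.length + 1)) (Fin (w.length + 1)) ℂ :=
  Matrix.of fun i j => if (j : ℕ) = i + 1 ∧ w[(i : ℕ)]? = some l then 1 else 0

/-- Products of letter matrices spell out `w`: the corner entry of a series in them is a coefficient. -/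
theorem wordSum_letterMatrix {ι : Type*} [Fintype ι] [DecidableEq ι] (w : List ι) (k : ℕ) :
    ∀ (f : List ι → ℂ) (i : Fin (w.length + 1)), w.length < k + i →
      wordSum (letterMatrix w) k f i (Fin.last _) = f (w.drop i) := by
  induction k with
  | zero => intro f i hi; omega
  | succ k ih =>
    intro f i hi
    rw [wordSum, Matrix.add_apply, Matrix.sum_apply, Matrix.smul_apply]
    by_cases hiw : (i : ℕ) = w.length
    · obtain rfl : i = Fin.last _ := Fin.ext hiw
      rw [sum_eq_zero]
      · simp
      · intro l _
        rw [Matrix.mul_apply]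
        refine sum_eq_zero fun r _ => ?_
        rw [letterMatrix, Matrix.of_apply, if_neg (by simp), zero_mul]
    · have hlt : (i : ℕ) < w.length := by omega
      rw [Matrix.one_apply_ne (fun h => hiw (by rw [h]; simp)), smul_zero, zero_add,
        sum_eq_single (w[(i : ℕ)])]
      · rw [Matrix.mul_apply, sum_eq_single (⟨i + 1, by omega⟩ : Fin (w.length + 1))]
        · rw [letterMatrix, Matrix.of_apply, if_pos ⟨rfl, by simp⟩, one_mul, ih _ _ (by simp; omega),
            List.drop_eq_getElem_cons hlt]
        · intro r _ hr
          rw [letterMatrix, Matrix.of_apply, if_neg (fun h => hr (Fin.ext h.1)), zero_mul]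
        · simp
      · intro l _ hl
        rw [Matrix.mul_apply]
        refine sum_eq_zero fun r _ => ?_
        rw [letterMatrix, Matrix.of_apply, if_neg (fun h => hl ?_), zero_mul]
        have h2 := h.2
        rw [List.getElem?_eq_getElem hlt] at h2
        exact (Option.some.inj h2).symm
      · simp

/-- The grading of the block index set: the positions of block `0` come right after those with the
same index in the other blocks. -/
def blockGrade (q : ℕ) (N : ℕ) : Fin (q + 1) × Fin (N + 1) → ℕ :=
  fun p => 2 * p.2 + if p.1 = 0 then 1 else 0

theorem lt_blockGrade_K (q N : ℕ) : N < (gradeFiltration (blockGrade q N) ℂ).K := by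
  have h : blockGrade q N (0, Fin.last N) ≤ univ.sup (blockGrade q N) := le_sup (mem_univ _)
  have h1 : blockGrade q N (0, Fin.last N) = 2 * N + 1 := by simp [blockGrade]
  change N < univ.sup (blockGrade q N) + 1
  omega

theorem letterMatrix_ne_zero {ι : Type*} [DecidableEq ι] {w : List ι} {l : ι}
    {i j : Fin (w.length + 1)} (h : letterMatrix w l i j ≠ 0) : (j : ℕ) = i + 1 := by
  rw [letterMatrix, Matrix.of_apply] at h
  by_contra h1
  exact h (if_neg fun h2 => h1 h2.1)

theorem blk_one_mem (q N : ℕ) (a : Fin (q + 1)) :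
    blk a a 1 ∈ (gradeFiltration (blockGrade q N) ℂ).F 0 := by
  refine blk_mem fun i j h => ?_
  obtain rfl : i = j := by
    by_contra h1
    exact h (Matrix.one_apply_ne h1)
  simp

theorem blk_letterMatrix_mem {ι : Type*} [DecidableEq ι] (w : List ι) (l : ι) (q : ℕ)
    (a b : Fin (q + 1)) :
    blk a b (letterMatrix w l) ∈ (gradeFiltration (blockGrade q w.length) ℂ).F 1 := by
  refine blk_mem fun i j h => ?_
  rw [blockGrade, blockGrade, letterMatrix_ne_zero h]
  dsimp only
  split_ifs <;> omega

theorem blk_one_zero_mem (q N : ℕ) {a : Fin (q + 1)} (ha : a ≠ 0) :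
    blk a 0 1 ∈ (gradeFiltration (blockGrade q N) ℂ).F 1 := by
  refine blk_mem fun i j h => ?_
  obtain rfl : i = j := by
    by_contra h1
    exact h (Matrix.one_apply_ne h1)
  simp [blockGrade, ha]

theorem corner_wordSum_apply {ι : Type*} [Fintype ι] [DecidableEq ι] (q : ℕ) (w : List ι)
    (a : Fin (q + 1)) (f : List ι → ℂ) :
    (blk a a 1 * wordSum (fun l => blk a a (letterMatrix w l))
      (gradeFiltration (blockGrade q w.length) ℂ).K f * blk a a 1 :
        Matrix (Fin (q + 1) × Fin (w.length + 1)) (Fin (q + 1) × Fin (w.length + 1)) ℂ)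
      (a, 0) (a, Fin.last _) = f w := by
  rw [corner_wordSum, blk_apply, if_pos ⟨rfl, rfl⟩, wordSum_letterMatrix]
  · simp
  · simpa using lt_blockGrade_K q w.length

end Corner

/-- Power series are determined by their values in the corners of the block matrices. -/
theorem eq_of_forall_evalAt {q : ℕ} {a : Fin (q + 1)} {f g : PowerSeries ℂ}
    (h : ∀ w : List Unit, ∀ hs : blk a a (letterMatrix w ()) ∈
      (gradeFiltration (blockGrade q w.length) ℂ).F 1,
      (gradeFiltration (blockGrade q w.length) ℂ).evalAt hs f * blk a a 1 =
        (gradeFiltration (blockGrade q w.length) ℂ).evalAt hs g * blk a a 1) : f = g := by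
  ext n
  have hs := blk_letterMatrix_mem (List.replicate n ()) () q a a
  have key : ∀ f : PowerSeries ℂ, (blk a a 1 * ((gradeFiltration
      (blockGrade q (List.replicate n ()).length) ℂ).evalAt hs f * blk a a 1) :
        Matrix (Fin (q + 1) × Fin ((List.replicate n ()).length + 1))
          (Fin (q + 1) × Fin ((List.replicate n ()).length + 1)) ℂ)
        (a, 0) (a, Fin.last _) = coeff n f := by
    intro f
    have h1 := (gradeFiltration (blockGrade q (List.replicate n ()).length) ℂ).wordSum_unit hs
      (fun t => coeff t.length f)
    have h2 : (PowerSeries.mk fun n => coeff (List.replicate n ()).length f) = f := by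
      ext k; simp
    rw [h2] at h1
    rw [← h1, ← mul_assoc]
    exact (corner_wordSum_apply q (List.replicate n ()) a fun t => coeff t.length f).trans (by simp)
  rw [← key f, ← key g, h _ hs]

/-! ### Corners of resolvents -/

section Resolvent

/-- Linearisation of `a c + c' a'`: in the corner of `e₀`, the resolvent of the pencil `a + a' + c + c'`
is the resolvent of `a c + c' a'`. -/
theorem resolvent_corner {R : Type*} [Ring R] {e₀ e₁ e₂ a a' c c' G : R}
    (hG : G = 1 + (a + a' + (c + c')) * G)
    (h00 : e₀ * e₀ = e₀) (h01 : e₀ * e₁ = 0) (h02 : e₀ * e₂ = 0) (h10 : e₁ * e₀ = 0)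
    (h12 : e₁ * e₂ = 0) (h20 : e₂ * e₀ = 0) (h21 : e₂ * e₁ = 0)
    (ha : e₀ * a = a) (ha₁ : a * e₁ = a) (hc : e₁ * c = c) (hc₀ : c * e₀ = c)
    (hc' : e₀ * c' = c') (hc₂ : c' * e₂ = c') (ha' : e₂ * a' = a') (ha₀ : a' * e₀ = a') :
    e₀ * G * e₀ = e₀ + (a * c + c' * a') * (e₀ * G * e₀) := by
  have kill : ∀ {e f b : R}, e * f = 0 → f * b = b → e * b = 0 := fun h h' => by
    rw [← h', ← mul_assoc, h, zero_mul]
  have hG0 : e₀ * G = e₀ + a * G + c' * G := by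
    conv_lhs => rw [hG]
    rw [mul_add, mul_one, ← mul_assoc, mul_add, mul_add, mul_add, ha, kill h02 ha', kill h01 hc, hc']
    noncomm_ring
  have hG1 : e₁ * G = e₁ + c * G := by
    conv_lhs => rw [hG]
    rw [mul_add, mul_one, ← mul_assoc, mul_add, mul_add, mul_add, hc, kill h12 ha', kill h10 ha,
      kill h10 hc']
    noncomm_ring
  have hG2 : e₂ * G = e₂ + a' * G := by
    conv_lhs => rw [hG]
    rw [mul_add, mul_one, ← mul_assoc, mul_add, mul_add, mul_add, ha', kill h21 hc, kill h20 ha,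
      kill h20 hc']
    noncomm_ring
  have h1 : a * G * e₀ = a * c * (e₀ * G * e₀) := by
    calc a * G * e₀ = a * (e₁ * G) * e₀ := by nth_rewrite 1 [← ha₁]; noncomm_ring
      _ = a * (e₁ * e₀) + a * (c * G) * e₀ := by rw [hG1]; noncomm_ring
      _ = a * ((c * e₀) * G) * e₀ := by rw [h10, hc₀, mul_zero, zero_add]
      _ = _ := by noncomm_ring
  have h2 : c' * G * e₀ = c' * a' * (e₀ * G * e₀) := by
    calc c' * G * e₀ = c' * (e₂ * G) * e₀ := by nth_rewrite 1 [← hc₂]; noncomm_ring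
      _ = c' * (e₂ * e₀) + c' * (a' * G) * e₀ := by rw [hG2]; noncomm_ring
      _ = c' * ((a' * e₀) * G) * e₀ := by rw [h20, ha₀, mul_zero, zero_add]
      _ = _ := by noncomm_ring
  conv_lhs => rw [hG0, add_mul, add_mul, h00, h1, h2]
  noncomm_ring

/-- Linearisation of a single product `a c`. -/
theorem resolvent_corner_two {R : Type*} [Ring R] {e₀ e₁ a c G : R}
    (hG : G = 1 + (a + c) * G) (h00 : e₀ * e₀ = e₀) (h01 : e₀ * e₁ = 0) (h10 : e₁ * e₀ = 0)
    (ha : e₀ * a = a) (ha₁ : a * e₁ = a) (hc : e₁ * c = c) (hc₀ : c * e₀ = c) :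
    e₀ * G * e₀ = e₀ + a * c * (e₀ * G * e₀) ∧ e₁ * G * e₀ = c * (e₀ * G * e₀) := by
  have kill : ∀ {e f b : R}, e * f = 0 → f * b = b → e * b = 0 := fun h h' => by
    rw [← h', ← mul_assoc, h, zero_mul]
  have hG0 : e₀ * G = e₀ + a * G := by
    conv_lhs => rw [hG]
    rw [mul_add, mul_one, ← mul_assoc, mul_add, ha, kill h01 hc, add_zero]
  have hG1 : e₁ * G = e₁ + c * G := by
    conv_lhs => rw [hG]
    rw [mul_add, mul_one, ← mul_assoc, mul_add, hc, kill h10 ha, zero_add]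
  have h1 : e₁ * G * e₀ = c * (e₀ * G * e₀) := by
    rw [hG1, add_mul, h10, zero_add]
    nth_rewrite 1 [← hc₀]
    noncomm_ring
  refine ⟨?_, h1⟩
  conv_lhs => rw [hG0, add_mul, h00]
  congr 1
  calc a * G * e₀ = a * (e₁ * G * e₀) := by nth_rewrite 1 [← ha₁]; noncomm_ring
    _ = _ := by rw [h1]; noncomm_ring

variable {n : Type*} [Fintype n] [DecidableEq n] {B : Type*} [Ring B] [Algebra ℂ B]
  {ι : Type*} [Fintype ι]

/-- The expectation of a resolvent that is cut down to a corner is again a moment series. -/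
theorem expect_corner (φ : UnitalFunctional B) (g : n → ℕ) (y : ι → B) {Λ : ι → Matrix n n ℂ}
    (hΛ : ∀ l, Λ l ∈ (gradeFiltration g ℂ).F 1) (b : B) (Z e : Matrix n n ℂ) {H : Matrix n n B}
    (hH : H = tens 1 e + (∑ l, tens (y l) (Λ l)) * H) :
    expect φ (tens b Z * H) = Z * wordSum Λ (gradeFiltration g ℂ).K
      (fun t => φ.toLin (b * (t.map y).prod)) * e := by
  have hT : ∑ l, tens (y l) (Λ l) ∈ (gradeFiltration g B).F 1 :=
    sum_mem fun l _ => tens_mem (hΛ l) _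
  have h1 := (gradeFiltration g B).geom_mul_one_sub hT
  set T := ∑ l, tens (y l) (Λ l) with hTdef
  have h2 : H = (∑ k ∈ range (gradeFiltration g ℂ).K, T ^ k) * tens 1 e := by
    have h3 : (1 - T) * H = tens 1 e := by
      rw [sub_mul, one_mul, sub_eq_iff_eq_add]; exact hH
    rw [← h3, ← mul_assoc]
    exact (one_mul H).symm.trans (congrArg (· * H) h1.symm)
  have h4 : tens b Z * H =
      tens 1 Z * (tens b 1 * ∑ k ∈ range (gradeFiltration g ℂ).K, T ^ k) * tens 1 e := by
    rw [h2, ← mul_assoc, ← mul_assoc, tens_mul_tens, one_mul, mul_one]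
  rw [h4, expect_mul_tens_one, expect_tens_one_mul, hTdef, expect_geom_sum]

end Resolvent

/-! ### The product of two free elements -/

theorem areFree_symm {B : Type*} [Ring B] [Algebra ℂ B] {φ : UnitalFunctional B} {S T : Set B}
    (h : φ.AreFree S T) : φ.AreFree T S := by
  intro l hl hchain hc
  have h1 := h (l.map fun p => (!p.1, p.2)) (by simpa using hl) ?_ ?_
  · simpa [List.map_map, Function.comp_def] using h1
  · rw [List.map_map, List.isChain_map] at *
    exact hchain.imp fun a b hab => by simpa using hab
  · intro p hp
    obtain ⟨r, hr, rfl⟩ := List.mem_map.1 hp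
    obtain ⟨h2, h3⟩ := hc r hr
    refine ⟨?_, h3⟩
    cases hr1 : r.1 <;> simpa [hr1] using h2

theorem rTransform_eq_mk {B : Type*} [Ring B] [Algebra ℂ B] (φ : UnitalFunctional B) (b : B) :
    φ.rTransform b = PowerSeries.mk fun k =>
      freeCumulant (fun t : List Unit => φ.toLin (t.map fun _ => b).prod) (List.replicate k ()) := by
  simp [UnitalFunctional.rTransform]

theorem constantCoeff_rTransform {B : Type*} [Ring B] [Algebra ℂ B] (φ : UnitalFunctional B) (b : B) :
    constantCoeff (φ.rTransform b) = 0 := by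
  rw [← coeff_zero_eq_constantCoeff_apply, UnitalFunctional.rTransform, coeff_mk]
  exact freeCumulant_nil _

/-- The series `∑ φ(c bᵏ) zᵏ`. -/
noncomputable def shiftedMoments {B : Type*} [Ring B] [Algebra ℂ B] (φ : UnitalFunctional B)
    (c b : B) : PowerSeries ℂ :=
  PowerSeries.mk fun k => φ.toLin (c * b ^ k)

theorem one_add_momentSeries {B : Type*} [Ring B] [Algebra ℂ B] (φ : UnitalFunctional B) (b : B) :
    1 + φ.momentSeries b = shiftedMoments φ 1 b := by
  ext k
  rw [map_add, coeff_one, UnitalFunctional.momentSeries, shiftedMoments, coeff_mk, coeff_mk]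
  by_cases hk : k = 0
  · simp [hk, φ.map_one]
  · simp [hk]

/-- Subordination for `b c` with `b`, `c` free: with `θ = z ∑ φ(c (b c)ᵏ) zᵏ` and
`η = z ∑ φ(b (c b)ᵏ) zᵏ`, one has `M_{bc} = R_b ∘ θ` and `θ = z (C₁ ∘ η) (1 + M_{bc})`,
where `R_c = z C₁`. -/
theorem momentSeries_mul_of_areFree {B : Type*} [Ring B] [Algebra ℂ B] (φ : UnitalFunctional B)
    {S T : Set B} (hfree : φ.AreFree S T) {b c : B} (hb : b ∈ S) (hc : c ∈ T)
    {C₁ : PowerSeries ℂ} (hC₁ : φ.rTransform c = X * C₁) :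
    φ.momentSeries (b * c) = subst (X * shiftedMoments φ c (b * c)) (φ.rTransform b) ∧
    X * shiftedMoments φ c (b * c) =
      X * subst (X * shiftedMoments φ b (c * b)) C₁ * (1 + φ.momentSeries (b * c)) := by
  have key : ∀ (w : List Unit) (hs : blk 0 0 (letterMatrix w ()) ∈
      (gradeFiltration (blockGrade 1 w.length) ℂ).F 1),
      (gradeFiltration (blockGrade 1 w.length) ℂ).evalAt hs (1 + φ.momentSeries (b * c)) *
          blk 0 0 1 =
        (gradeFiltration (blockGrade 1 w.length) ℂ).evalAt hs
          (1 + subst (X * shiftedMoments φ c (b * c)) (φ.rTransform b)) * blk 0 0 1 ∧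
      (gradeFiltration (blockGrade 1 w.length) ℂ).evalAt hs (X * shiftedMoments φ c (b * c)) *
          blk 0 0 1 =
        (gradeFiltration (blockGrade 1 w.length) ℂ).evalAt hs
          (X * subst (X * shiftedMoments φ b (c * b)) C₁ * (1 + φ.momentSeries (b * c))) *
          blk 0 0 1 := by
    intro w hs
    set Φ := gradeFiltration (blockGrade 1 w.length) ℂ with hΦ
    set J := letterMatrix w () with hJ
    set e₀ : Matrix (Fin 2 × Fin (w.length + 1)) (Fin 2 × Fin (w.length + 1)) ℂ := blk 0 0 1 with he₀
    set e₁ : Matrix (Fin 2 × Fin (w.length + 1)) (Fin 2 × Fin (w.length + 1)) ℂ := blk 1 1 1 with he₁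
    set x : Matrix (Fin 2 × Fin (w.length + 1)) (Fin 2 × Fin (w.length + 1)) ℂ := blk 0 1 J with hx
    set z : Matrix (Fin 2 × Fin (w.length + 1)) (Fin 2 × Fin (w.length + 1)) ℂ := blk 1 0 1 with hz
    have hx1 : x ∈ Φ.F 1 := blk_letterMatrix_mem w () 1 0 1
    have hz1 : z ∈ Φ.F 1 := blk_one_zero_mem 1 w.length (by decide)
    have h00 : e₀ * e₀ = e₀ := by rw [he₀, blk_mul, mul_one]
    have h11 : e₁ * e₁ = e₁ := by rw [he₁, blk_mul, mul_one]
    have h01 : e₀ * e₁ = 0 := blk_mul_of_ne (by decide) _ _ _ _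
    have h10 : e₁ * e₀ = 0 := blk_mul_of_ne (by decide) _ _ _ _
    have hxl : e₀ * x = x := by rw [he₀, hx, blk_mul, one_mul]
    have hxr : x * e₁ = x := by rw [he₁, hx, blk_mul, mul_one]
    have hzl : e₁ * z = z := by rw [he₁, hz, blk_mul, one_mul]
    have hzr : z * e₀ = z := by rw [he₀, hz, blk_mul, mul_one]
    have hxz : x * z = blk 0 0 J := by rw [hx, hz, blk_mul, mul_one]
    have hs' : x * z ∈ Φ.F 1 := NilFiltration.mul_mem_one hx1 hz1
    have ht : z * x ∈ Φ.F 1 := NilFiltration.mul_mem_one hz1 hx1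
    have hT : tens b x + tens c z ∈ (gradeFiltration (blockGrade 1 w.length) B).F 1 :=
      add_mem (tens_mem hx1 _) (tens_mem hz1 _)
    obtain ⟨G, hGl, hGr⟩ : ∃ G, G * (1 - (tens b x + tens c z)) = 1 ∧
        (1 - (tens b x + tens c z)) * G = 1 :=
      ⟨_, NilFiltration.geom_mul_one_sub _ hT, NilFiltration.one_sub_mul_geom _ hT⟩
    have hGeq : G = 1 + (tens b x + tens c z) * G := by
      rw [sub_mul, one_mul, sub_eq_iff_eq_add] at hGr; exact hGr
    have tmul : ∀ {a : B} {p r s : Matrix (Fin 2 × Fin (w.length + 1)) _ ℂ}, p * r = s →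
        tens 1 p * tens a r = tens a s := fun h => by rw [tens_mul_tens, one_mul, h]
    have tmul' : ∀ {a : B} {p r s : Matrix (Fin 2 × Fin (w.length + 1)) _ ℂ}, p * r = s →
        tens a p * tens 1 r = tens a s := fun h => by rw [tens_mul_tens, mul_one, h]
    have t0 : tens (1 : B) (0 : Matrix (Fin 2 × Fin (w.length + 1)) _ ℂ) = 0 := tens_zero 1
    obtain ⟨hc0, hc10⟩ := resolvent_corner_two hGeq (tmul h00) ((tmul h01).trans t0)
      ((tmul h10).trans t0) (tmul hxl) (tmul' hxr) (tmul hzl) (tmul' hzr)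
    obtain ⟨hc1, hc01⟩ := resolvent_corner_two (hGeq.trans (by rw [add_comm (tens b x)]))
      (tmul h11) ((tmul h10).trans t0)
      ((tmul h01).trans t0) (tmul hzl) (tmul' hzr) (tmul hxl) (tmul' hxr)
    rw [tens_mul_tens] at hc0 hc1
    obtain ⟨hW0, hW⟩ := expect_resolvent_of_areFree φ hfree (blockGrade 1 w.length)
      (ι := Unit) (ι' := Unit) (x := fun _ => b) (y := fun _ => c) (fun _ => hb) (fun _ => hc)
      (Λ := fun _ => x) (Λ' := fun _ => z) (fun _ => hx1) (fun _ => hz1) (G := G) (by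
        simpa using hGl)
    set W := expect φ G with hWdef
    have hxW : x * W ∈ Φ.F 1 := NilFiltration.mul_mem_left hx1 hW0
    have hzW : z * W ∈ Φ.F 1 := NilFiltration.mul_mem_left hz1 hW0
    rw [Φ.wordSum_unit hxW, Φ.wordSum_unit hzW, ← rTransform_eq_mk, ← rTransform_eq_mk] at hW
    have hcorner : ∀ (d y : B) (s Z e : Matrix (Fin 2 × Fin (w.length + 1)) _ ℂ) (hs : s ∈ Φ.F 1)
        (H : Matrix (Fin 2 × Fin (w.length + 1)) (Fin 2 × Fin (w.length + 1)) B),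
        H = tens 1 e + tens y s * H →
        expect φ (tens d Z * H) = Z * Φ.evalAt hs (shiftedMoments φ d y) * e := by
      intro d y s Z e hs H hH
      rw [expect_corner φ (blockGrade 1 w.length) (ι := Unit) (fun _ => y) (Λ := fun _ => s)
        (fun _ => hs) d Z e (by simpa using hH), Φ.wordSum_unit hs]
      simp [shiftedMoments]
    have hE : ∀ p r : Matrix (Fin 2 × Fin (w.length + 1)) _ ℂ,
        expect φ (tens 1 p * G * tens 1 r) = p * W * r := fun p r => by
      rw [expect_mul_tens_one, expect_tens_one_mul]
    have k00 : e₀ * W * e₀ = Φ.evalAt hs' (1 + φ.momentSeries (b * c)) * e₀ := by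
      rw [← hE, ← one_mul (tens 1 e₀ * G * tens 1 e₀), ← tens_one_one,
        hcorner _ _ _ _ _ hs' _ hc0, one_mul, one_add_momentSeries]
    have k10 : e₁ * W * e₀ = z * Φ.evalAt hs' (shiftedMoments φ c (b * c)) * e₀ := by
      rw [← hE, hc10, hcorner _ _ _ _ _ hs' _ hc0]
    have k01 : e₀ * W * e₁ = x * Φ.evalAt ht (shiftedMoments φ b (c * b)) * e₁ := by
      rw [← hE, hc01, hcorner _ _ _ _ _ ht _ hc1]
    have := Φ.product_subordination h00 h01 h10 hxl hxr hzl hzr (constantCoeff_rTransform φ b) hC₁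
      hxW hzW hs' ht hW k00 k10 k01
    simpa only [Φ.evalAt_congr hxz hs' hs] using this
  constructor
  · exact add_left_cancel (eq_of_forall_evalAt (q := 1) (a := 0) fun w hs => (key w hs).1)
  · exact eq_of_forall_evalAt (q := 1) (a := 0) fun w hs => (key w hs).2

/-! ### The product of two free `R`-diagonal elements -/

open Classical in
/-- The free cumulants of the `R`-diagonal distribution with determining series `f` and `g`. -/
noncomputable def altCumulant (f g : PowerSeries ℂ) (w : List StarLetter) : ℂ :=
  if w = StarDistribution.altOneStar (w.length / 2) then coeff (w.length / 2) f
  else if w = StarDistribution.altStarOne (w.length / 2) then coeff (w.length / 2) g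
  else 0

theorem length_altOneStar (k : ℕ) : (StarDistribution.altOneStar k).length = 2 * k := by
  rw [← NilFiltration.altWord_one_two_mul, NilFiltration.length_altWord]

theorem length_altStarOne (k : ℕ) : (StarDistribution.altStarOne k).length = 2 * k := by
  rw [← NilFiltration.altWord_star_two_mul, NilFiltration.length_altWord]

theorem altCumulant_altOneStar (f g : PowerSeries ℂ) (k : ℕ) :
    altCumulant f g (StarDistribution.altOneStar k) = coeff k f := by
  have h : (StarDistribution.altOneStar k).length / 2 = k := by rw [length_altOneStar]; omega
  rw [altCumulant, h, if_pos rfl]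

theorem altCumulant_altStarOne {f g : PowerSeries ℂ} (hf : constantCoeff f = 0)
    (hg : constantCoeff g = 0) (k : ℕ) :
    altCumulant f g (StarDistribution.altStarOne k) = coeff k g := by
  have h : (StarDistribution.altStarOne k).length / 2 = k := by rw [length_altStarOne]; omega
  rw [altCumulant, h]
  cases k with
  | zero =>
    rw [coeff_zero_eq_constantCoeff_apply, coeff_zero_eq_constantCoeff_apply, hf, hg]; simp
  | succ k =>
    rw [if_neg, if_pos rfl]
    simp [StarDistribution.altOneStar, StarDistribution.altStarOne, List.replicate_succ]

theorem altCumulant_of_not_isAlternating (f g : PowerSeries ℂ) (w : List StarLetter) (hw : w ≠ [])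
    (h : ¬ StarDistribution.IsAlternating w) : altCumulant f g w = 0 := by
  have h1 : ∀ k, w = StarDistribution.altOneStar k ∨ w = StarDistribution.altStarOne k → False := by
    intro k hk
    refine h ⟨k, Nat.one_le_iff_ne_zero.2 ?_, hk⟩
    rintro rfl
    exact hw (by simpa [StarDistribution.altOneStar, StarDistribution.altStarOne] using hk)
  rw [altCumulant, if_neg fun h2 => h1 _ (Or.inl h2), if_neg fun h2 => h1 _ (Or.inr h2)]

theorem toLin_starMonomial {B : Type*} [Ring B] [Algebra ℂ B] [Star B] (ψ : UnitalFunctional B)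
    (x : B) (w : List StarLetter) :
    (ψ.starDistribution x).toLin (starMonomial w) = ψ.toLin (w.map (starPow x)).prod := by
  simp [UnitalFunctional.starDistribution, starMonomial, map_list_prod, List.map_map,
    Function.comp_def]

theorem rCoeff_starDistribution {B : Type*} [Ring B] [Algebra ℂ B] [Star B] (ψ : UnitalFunctional B)
    (x : B) : (ψ.starDistribution x).rCoeff =
      freeCumulant fun t => ψ.toLin (t.map (starPow x)).prod := by
  unfold StarDistribution.rCoeff
  simp only [toLin_starMonomial]

theorem constantCoeff_subst_eq_zero {f g : PowerSeries ℂ} (hf : constantCoeff f = 0)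
    (hg : constantCoeff g = 0) : constantCoeff (subst g f) = 0 := by
  have hs : HasSubst g := HasSubst.of_constantCoeff_zero' hg
  obtain ⟨f', rfl⟩ := X_dvd_iff.2 hf
  rw [subst_mul hs, subst_X hs, map_mul, hg, zero_mul]

/-- The cumulants of the product of two `*`-free `R`-diagonal elements, in terms of a solution of the
subordination equations. -/
theorem rCoeff_mul_of_areFree {B : Type*} [Ring B] [StarRing B] [Algebra ℂ B]
    (ψ : UnitalFunctional B) {x x' : B} (hfree : ψ.AreFree {x, star x} {x', star x'})
    (hx : (ψ.starDistribution x).IsRDiagonal) (hx' : (ψ.starDistribution x').IsRDiagonal)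
    {A₁ B₁ θ η : PowerSeries ℂ}
    (hA₁ : PowerSeries.mk (ψ.starDistribution x').alpha = X * A₁)
    (hB₁ : PowerSeries.mk (ψ.starDistribution x).beta = X * B₁)
    (hθ0 : constantCoeff θ = 0) (hη0 : constantCoeff η = 0)
    (hθ : θ = X * subst η A₁ * (1 + subst θ (PowerSeries.mk (ψ.starDistribution x).beta)))
    (hη : η = X * subst θ B₁ * (1 + subst η (PowerSeries.mk (ψ.starDistribution x').alpha))) :
    (ψ.starDistribution (x * x')).rCoeff =
      altCumulant (subst θ (PowerSeries.mk (ψ.starDistribution x).alpha))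
        (subst η (PowerSeries.mk (ψ.starDistribution x').beta)) := by
  set A := PowerSeries.mk (ψ.starDistribution x).alpha with hA
  set A' := PowerSeries.mk (ψ.starDistribution x').alpha with hA'
  set C := PowerSeries.mk (ψ.starDistribution x).beta with hC
  set C' := PowerSeries.mk (ψ.starDistribution x').beta with hC'
  have hA0 : constantCoeff A = 0 := by
    rw [← coeff_zero_eq_constantCoeff_apply, hA, coeff_mk, StarDistribution.alpha_zero]
  have hC0' : constantCoeff C' = 0 := by
    rw [← coeff_zero_eq_constantCoeff_apply, hC', coeff_mk, StarDistribution.beta_zero]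
  set f := subst θ A with hf
  set g := subst η C' with hg
  have hf0 : constantCoeff f = 0 := constantCoeff_subst_eq_zero hA0 hθ0
  have hg0 : constantCoeff g = 0 := constantCoeff_subst_eq_zero hC0' hη0
  have hnil : altCumulant f g [] = 0 := by
    have := altCumulant_altOneStar f g 0
    rwa [coeff_zero_eq_constantCoeff_apply, hf0] at this
  have hmk₁ : (PowerSeries.mk fun n => altCumulant f g (StarDistribution.altOneStar n)) = f := by
    ext n; rw [coeff_mk, altCumulant_altOneStar]
  have hmk₂ : (PowerSeries.mk fun n => altCumulant f g (StarDistribution.altStarOne n)) = g := by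
    ext n; rw [coeff_mk, altCumulant_altStarOne hf0 hg0]
  -- it is enough to compare moments
  suffices hmom : (fun w : List StarLetter => ψ.toLin (w.map (starPow (x * x'))).prod) =
      ncMoment (altCumulant f g) by
    rw [rCoeff_starDistribution, hmom]
    exact funext fun w => freeCumulant_ncMoment _ hnil w
  funext w
  let n := Fin 3 × Fin (w.length + 1)
  let Φ := gradeFiltration (blockGrade 2 w.length) ℂ
  let T := letterMatrix w
  let e₀ : Matrix n n ℂ := blk 0 0 1
  let e₁ : Matrix n n ℂ := blk 1 1 1
  let e₂ : Matrix n n ℂ := blk 2 2 1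
  let p : Matrix n n ℂ := blk 0 1 (T .one)
  let p' : Matrix n n ℂ := blk 2 0 1
  let z : Matrix n n ℂ := blk 1 0 1
  let z' : Matrix n n ℂ := blk 0 2 (T .star)
  have hp : p ∈ Φ.F 1 := blk_letterMatrix_mem w _ 2 0 1
  have hz' : z' ∈ Φ.F 1 := blk_letterMatrix_mem w _ 2 0 2
  have hp' : p' ∈ Φ.F 1 := blk_one_zero_mem 2 w.length (by decide)
  have hz : z ∈ Φ.F 1 := blk_one_zero_mem 2 w.length (by decide)
  have he₀ : e₀ ∈ Φ.F 0 := blk_one_mem 2 w.length 0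
  have h00 : e₀ * e₀ = e₀ := (blk_mul _ _ _ _ _).trans (congrArg _ (mul_one _))
  have h01 : e₀ * e₁ = 0 := blk_mul_of_ne (by decide) _ _ _ _
  have h02 : e₀ * e₂ = 0 := blk_mul_of_ne (by decide) _ _ _ _
  have h10 : e₁ * e₀ = 0 := blk_mul_of_ne (by decide) _ _ _ _
  have h12 : e₁ * e₂ = 0 := blk_mul_of_ne (by decide) _ _ _ _
  have h20 : e₂ * e₀ = 0 := blk_mul_of_ne (by decide) _ _ _ _
  have h21 : e₂ * e₁ = 0 := blk_mul_of_ne (by decide) _ _ _ _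
  have hpl : e₀ * p = p := (blk_mul _ _ _ _ _).trans (congrArg _ (one_mul _))
  have hpr : p * e₁ = p := (blk_mul _ _ _ _ _).trans (congrArg _ (mul_one _))
  have hpl' : e₂ * p' = p' := (blk_mul _ _ _ _ _).trans (congrArg _ (one_mul _))
  have hpr' : p' * e₀ = p' := (blk_mul _ _ _ _ _).trans (congrArg _ (mul_one _))
  have hzl : e₁ * z = z := (blk_mul _ _ _ _ _).trans (congrArg _ (one_mul _))
  have hzr : z * e₀ = z := (blk_mul _ _ _ _ _).trans (congrArg _ (mul_one _))
  have hzl' : e₀ * z' = z' := (blk_mul _ _ _ _ _).trans (congrArg _ (one_mul _))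
  have hzr' : z' * e₂ = z' := (blk_mul _ _ _ _ _).trans (congrArg _ (mul_one _))
  have hy₁ : p * z = blk 0 0 (T .one) := (blk_mul _ _ _ _ _).trans (congrArg _ (mul_one _))
  have hy₂ : z' * p' = blk 0 0 (T .star) := (blk_mul _ _ _ _ _).trans (congrArg _ (mul_one _))
  let Λ : StarLetter → Matrix n n ℂ := fun l => match l with | .one => p | .star => p'
  let Λ' : StarLetter → Matrix n n ℂ := fun l => match l with | .one => z | .star => z'
  let Y : StarLetter → Matrix n n ℂ := fun l => blk 0 0 (T l)
  have hΛ : ∀ l, Λ l ∈ Φ.F 1 := by rintro (_ | _); exacts [hp, hp']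
  have hΛ' : ∀ l, Λ' l ∈ Φ.F 1 := by rintro (_ | _); exacts [hz, hz']
  have hY : ∀ l, Y l ∈ Φ.F 1 := fun l => blk_letterMatrix_mem w l 2 0 0
  have hS : ∀ l, starPow x l ∈ ({x, star x} : Set B) := by rintro (_ | _) <;> simp [starPow]
  have hS' : ∀ l, starPow x' l ∈ ({x', star x'} : Set B) := by rintro (_ | _) <;> simp [starPow]
  have hTm : ∑ l, tens (starPow x l) (Λ l) + ∑ l, tens (starPow x' l) (Λ' l) ∈
      (gradeFiltration (blockGrade 2 w.length) B).F 1 :=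
    add_mem (sum_mem fun l _ => tens_mem (hΛ l) _) (sum_mem fun l _ => tens_mem (hΛ' l) _)
  obtain ⟨G, hGl, hGr⟩ : ∃ G,
      G * (1 - (∑ l, tens (starPow x l) (Λ l) + ∑ l, tens (starPow x' l) (Λ' l))) = 1 ∧
      (1 - (∑ l, tens (starPow x l) (Λ l) + ∑ l, tens (starPow x' l) (Λ' l))) * G = 1 :=
    ⟨_, NilFiltration.geom_mul_one_sub _ hTm, NilFiltration.one_sub_mul_geom _ hTm⟩
  obtain ⟨hW0, hW⟩ := expect_resolvent_of_areFree ψ hfree (blockGrade 2 w.length) hS hS' hΛ hΛ' hGl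
  -- the corner of the resolvent is the resolvent of `x x'`
  have hGeq : G = 1 + (tens x p + tens (star x) p' + (tens x' z + tens (star x') z')) * G := by
    rw [sub_mul, one_mul, sub_eq_iff_eq_add, NilFiltration.sum_starLetter, NilFiltration.sum_starLetter] at hGr
    exact hGr
  have tmul : ∀ {a : B} {r s t : Matrix n n ℂ}, r * s = t →
      tens 1 r * tens a s = tens a t := fun h => by rw [tens_mul_tens, one_mul, h]
  have tmul' : ∀ {a : B} {r s t : Matrix n n ℂ}, r * s = t →
      tens a r * tens 1 s = tens a t := fun h => by rw [tens_mul_tens, mul_one, h]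
  have tz : ∀ {r s : Matrix n n ℂ}, r * s = 0 → tens (1 : B) r * tens 1 s = 0 := fun h => by
    rw [tens_mul_tens, h, tens_zero]
  have hcor := resolvent_corner hGeq (tmul h00) (tz h01) (tz h02) (tz h10) (tz h12) (tz h20)
    (tz h21) (tmul hpl) (tmul' hpr) (tmul hzl) (tmul' hzr) (tmul hzl') (tmul' hzr') (tmul hpl')
    (tmul' hpr')
  have hsumY : ∑ l, tens (starPow (x * x') l) (Y l) =
      tens x p * tens x' z + tens (star x') z' * tens (star x) p' := by
    rw [NilFiltration.sum_starLetter, tens_mul_tens, tens_mul_tens, hy₁, hy₂]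
    simp [starPow, Y]
  rw [← hsumY] at hcor
  have hWcor := expect_corner ψ (blockGrade 2 w.length) (starPow (x * x')) hY 1 1 e₀ hcor
  rw [tens_one_one, one_mul, expect_mul_tens_one, expect_tens_one_mul, one_mul] at hWcor
  simp only [one_mul] at hWcor
  -- the functional equation for the four letters
  set W := expect ψ G with hWdef
  have hΛW : ∀ l, Λ l * W ∈ Φ.F 1 := fun l => NilFiltration.mul_mem_left (hΛ l) hW0
  have hΛW' : ∀ l, Λ' l * W ∈ Φ.F 1 := fun l => NilFiltration.mul_mem_left (hΛ' l) hW0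
  have mul1 : ∀ {a b : Matrix n n ℂ}, a ∈ Φ.F 1 → b ∈ Φ.F 1 → a * b ∈ Φ.F 1 := fun ha hb =>
    NilFiltration.mul_mem_one ha hb
  have hU : p * W * (p' * W) ∈ Φ.F 1 := mul1 (hΛW .one) (hΛW .star)
  have hUt : p' * W * (p * W) ∈ Φ.F 1 := mul1 (hΛW .star) (hΛW .one)
  have hVt : z * W * (z' * W) ∈ Φ.F 1 := mul1 (hΛW' .one) (hΛW' .star)
  have hV : z' * W * (z * W) ∈ Φ.F 1 := mul1 (hΛW' .star) (hΛW' .one)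
  rw [← rCoeff_starDistribution, ← rCoeff_starDistribution,
    Φ.wordSum_of_alternating hΛW (ψ.starDistribution x).rCoeff (freeCumulant_nil _) hx hU hUt,
    Φ.wordSum_of_alternating hΛW' (ψ.starDistribution x').rCoeff (freeCumulant_nil _) hx' hVt hV] at hW
  obtain ⟨hWA, hUeq, hVeq⟩ := Φ.subordination_of_block h10 h20 h01 h02 h12 h21 hpl hpr hzl hzl' hzr'
    hpl' hA0 hC0' hA₁ hB₁ hU hUt hVt hV hW
  have hY₁ : p * z ∈ Φ.F 1 := mul1 hp hz
  have hY₂ : z' * p' ∈ Φ.F 1 := mul1 hz' hp'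
  have left0 : ∀ {a b : Matrix n n ℂ}, a ∈ Φ.F 1 → b ∈ Φ.F 0 → a * b ∈ Φ.F 1 := fun ha hb =>
    NilFiltration.mul_mem_left ha hb
  have hs : p * z * W * (z' * p' * W) ∈ Φ.F 1 := mul1 (left0 hY₁ hW0) (left0 hY₂ hW0)
  have ht : z' * p' * W * (p * z * W) ∈ Φ.F 1 := mul1 (left0 hY₂ hW0) (left0 hY₁ hW0)
  obtain ⟨hUθ, hVη⟩ := Φ.subordination_unique hY₁ hY₂ hW0 hU hV hs ht hθ0 hη0 hθ hη hUeq hVeq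
  rw [Φ.evalAt_congr hUθ hU (Φ.evalAt_mem_one hs hθ0), ← Φ.evalAt_subst hs hθ0,
    Φ.evalAt_congr hVη hV (Φ.evalAt_mem_one ht hη0), ← Φ.evalAt_subst ht hη0] at hWA
  -- the moments with cumulants `altCumulant f g` satisfy the same equation
  set V := wordSum Y Φ.K (ncMoment (altCumulant f g)) with hVdef
  have hV0 : V ∈ Φ.F 0 := Φ.wordSum_mem hY _ _
  have hVeq' := Φ.wordSum_moment hY (ncMoment_nil (altCumulant f g))
  rw [← hVdef] at hVeq'
  have hYV : ∀ l, Y l * V ∈ Φ.F 1 := fun l => left0 (hY l) hV0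
  have hYs : Y .one * V * (Y .star * V) = p * z * V * (z' * p' * V) := by
    rw [show Y .one = p * z from hy₁.symm, show Y .star = z' * p' from hy₂.symm]
  have hYt : Y .star * V * (Y .one * V) = z' * p' * V * (p * z * V) := by
    rw [show Y .one = p * z from hy₁.symm, show Y .star = z' * p' from hy₂.symm]
  have hs₁ : p * z * V * (z' * p' * V) ∈ Φ.F 1 := mul1 (left0 hY₁ hV0) (left0 hY₂ hV0)
  have ht₁ : z' * p' * V * (p * z * V) ∈ Φ.F 1 := mul1 (left0 hY₂ hV0) (left0 hY₁ hV0)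
  have hκ : freeCumulant (ncMoment (altCumulant f g)) = altCumulant f g :=
    funext fun t => freeCumulant_ncMoment _ hnil t
  rw [hκ, Φ.wordSum_of_alternating hYV _ hnil (altCumulant_of_not_isAlternating f g)
    (mul1 (hYV _) (hYV _)) (mul1 (hYV _) (hYV _)), hmk₁, hmk₂,
    Φ.evalAt_congr hYs _ hs₁, Φ.evalAt_congr hYt _ ht₁] at hVeq'
  have hVA : e₀ * V = e₀ + Φ.evalAt hs₁ f + Φ.evalAt ht₁ g := by
    conv_lhs => rw [hVeq']
    rw [mul_add, mul_add, mul_one,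
      Φ.mul_evalAt_of_mul_eq_self hs₁ (e := e₀) (by simp only [← mul_assoc, hpl]) hf0,
      Φ.mul_evalAt_of_mul_eq_self ht₁ (e := e₀) (by simp only [← mul_assoc, hzl']) hg0, add_assoc]
  have hWV : e₀ * W = e₀ * V := Φ.corner_unique he₀ (by rw [mul_assoc, hzr])
    (by rw [mul_assoc, hpr']) hY₁ hY₂ hW0 hV0 hs ht hs₁ ht₁ hWA hVA
  -- read off the coefficient of the word `w`
  have hfin : e₀ * wordSum Y Φ.K (fun t => ψ.toLin (t.map (starPow (x * x'))).prod) * e₀ =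
      e₀ * V * e₀ := by
    rw [mul_assoc, ← hWcor, ← hWV, ← mul_assoc, ← mul_assoc, h00]
  have h1 := corner_wordSum_apply 2 w 0 (fun t => ψ.toLin (t.map (starPow (x * x'))).prod)
  have h2 := corner_wordSum_apply 2 w 0 (ncMoment (altCumulant f g))
  rw [← h1, ← h2]
  exact congr_fun (congr_fun hfin _) _

end FreeProduct

theorem proposition7p2 (μ μ' ν : StarDistribution)
    (hν : IsFreeMulConv.{u} μ μ' ν)
    (hμ : μ.IsRDiagonal) (hμ' : μ'.IsRDiagonal)
    (A : Type v) [Ring A] [Algebra ℂ A] (φ : UnitalFunctional A) (a b a' b' : A)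
    (hfree : φ.AreFree {a, b} {a', b'})
    (ha : φ.rTransform a = PowerSeries.mk μ.alpha)
    (hb : φ.rTransform b = PowerSeries.mk μ.beta)
    (ha' : φ.rTransform a' = PowerSeries.mk μ'.alpha)
    (hb' : φ.rTransform b' = PowerSeries.mk μ'.beta)
    (hβ : μ.beta 1 ≠ 0) (hα' : μ'.alpha 1 ≠ 0) :
    ν.IsRDiagonal ∧
    PowerSeries.mk ν.alpha =
      seriesComp (seriesComp (φ.rTransform a) (seriesCompInv (φ.rTransform b)))
        (φ.momentSeries (b * a')) ∧
    PowerSeries.mk ν.beta =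
      seriesComp (seriesComp (φ.rTransform b') (seriesCompInv (φ.rTransform a')))
        (φ.momentSeries (a' * b)) := by
  obtain ⟨B, _, ψ, x, x', -, hψ, rfl, rfl, rfl⟩ := hν
  obtain ⟨A₁, hA₁⟩ := PowerSeries.X_dvd_iff.2 (FreeProduct.constantCoeff_rTransform φ a')
  obtain ⟨B₁, hB₁⟩ := PowerSeries.X_dvd_iff.2 (FreeProduct.constantCoeff_rTransform φ b)
  obtain ⟨hM, hθ⟩ := FreeProduct.momentSeries_mul_of_areFree φ hfree
    (b := b) (c := a') (by simp) (by simp) hA₁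
  obtain ⟨hM', hη⟩ := FreeProduct.momentSeries_mul_of_areFree φ (FreeProduct.areFree_symm hfree)
    (b := a') (c := b) (by simp) (by simp) hB₁
  set θ := PowerSeries.X * FreeProduct.shiftedMoments φ a' (b * a') with hθdef
  set η := PowerSeries.X * FreeProduct.shiftedMoments φ b (a' * b) with hηdef
  have hθ0 : PowerSeries.constantCoeff θ = 0 := by simp [hθdef]
  have hη0 : PowerSeries.constantCoeff η = 0 := by simp [hηdef]
  rw [hM] at hθ
  rw [hM'] at hη
  have key := FreeProduct.rCoeff_mul_of_areFree ψ hψ hμ hμ' (ha' ▸ hA₁) (hb ▸ hB₁) hθ0 hη0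
    (hb ▸ hθ) (ha' ▸ hη)
  rw [← ha, ← hb'] at key
  -- `R⁻¹ ∘ (R ∘ θ) = θ`
  have hcomp : ∀ {R S θ : PowerSeries ℂ}, PowerSeries.constantCoeff R = 0 →
      PowerSeries.coeff 1 R ≠ 0 → PowerSeries.constantCoeff θ = 0 →
      seriesComp (seriesComp S (seriesCompInv R)) (PowerSeries.subst θ R) =
        PowerSeries.subst θ S := by
    intro R S θ hR hR1 hθ
    have hs : PowerSeries.HasSubst θ := PowerSeries.HasSubst.of_constantCoeff_zero' hθ
    have hsR : PowerSeries.HasSubst R := PowerSeries.HasSubst.of_constantCoeff_zero' hR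
    have hsI : PowerSeries.HasSubst (seriesCompInv R) := by
      refine PowerSeries.HasSubst.of_constantCoeff_zero' ?_
      simp only [seriesCompInv, dif_pos hR1.isUnit]
      exact PowerSeries.constantCoeff_substInvOfIsUnit ..
    rw [seriesComp, seriesComp, ← PowerSeries.subst_comp_subst_apply hsR hs,
      PowerSeries.subst_comp_subst_apply hsI hsR]
    have := (seriesComp_compInv R hR hR1).2
    rw [seriesComp] at this
    rw [this, ← PowerSeries.map_algebraMap_eq_subst_X]
    simp
  have hα0 : PowerSeries.constantCoeff (PowerSeries.subst θ (φ.rTransform a)) = 0 :=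
    FreeProduct.constantCoeff_subst_eq_zero (FreeProduct.constantCoeff_rTransform φ a) hθ0
  have hβ0 : PowerSeries.constantCoeff (PowerSeries.subst η (φ.rTransform b')) = 0 :=
    FreeProduct.constantCoeff_subst_eq_zero (FreeProduct.constantCoeff_rTransform φ b') hη0
  refine ⟨fun w hw hw' => ?_, ?_, ?_⟩
  · rw [key]
    exact FreeProduct.altCumulant_of_not_isAlternating _ _ w hw hw'
  · rw [hM, hcomp (FreeProduct.constantCoeff_rTransform φ b)
      (by rw [hb, PowerSeries.coeff_mk]; exact hβ) hθ0]
    ext n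
    rw [PowerSeries.coeff_mk, StarDistribution.alpha, key, FreeProduct.altCumulant_altOneStar]
  · rw [hM', hcomp (FreeProduct.constantCoeff_rTransform φ a')
      (by rw [ha', PowerSeries.coeff_mk]; exact hα') hη0]
    ext n
    rw [PowerSeries.coeff_mk, StarDistribution.beta, key,
      FreeProduct.altCumulant_altStarOne hα0 hβ0]
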